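/- Let $A$ be a complex unital Banach algebra. For $a,b\in A$ let $C_{a,b}:A\to A$, $C_{a,b}x=ax-xb$, and put $$\rho(a,b)=\limsup_{n\to\infty}\|C_{a,b}^n\mathbf 1\|^{1/n},\qquad d_\rho(a,b)=\max\{\rho(a,b),\rho(b,a)\};$$ $a$ and $b$ are called quasinilpotent equivalent if $d_\rho(a,b)=0$. For $f$ holomorphic on an open set $U\supseteq\sigma(a)$ let $$f(a)=\frac1{2\pi i}\int_\Gamma f(z)(z\mathbf 1-a)^{-1}\,dz,$$ where $\Gamma$ is a contour (a cycle made of finitely many oriented line segments) in $U\setminus\sigma(a)$ with index $1$ about every point of $\sigma(a)$ and index $0$ about every point outside $U$. **Theorem 2.1.** Let $a,b\in A$, let $U\subseteq\mathbb C$ be open and let $f$ be holomorphic on $U$. (1) If $\sigma(a)\cup\sigma(b)\subseteq U$, then $$\rho(f(a),f(b))\le\sup_{\omega\in\sigma(b)}\max\left\{\sup_{\lambda\in\sigma(a),\,\lambda\ne\omega}\left|\frac{f(\lambda)-f(\omega)}{\lambda-\omega}\right|,\ |f'(\omega)|\right\}\cdot\rho(a,b),$$ where the supremum is finite (a supremum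 over the empty set is read as $0$). Moreover, the same inequality holds with the supremum replaced by the supremum over all $\omega\in\sigma(b)$, $\lambda\in\sigma(a)$ of $\left|\frac{f(\lambda)-f(\omega)}{\lambda-\omega}\right|$ if $\lambda\neq\omega$, respectively of $|f'(\omega)|$ if $\lambda=\omega$. (2) If $\sigma(a)\subseteq U$ and $d_\rho(a,b)=0$, then $\sigma(a)=\sigma(b)$ and $d_\rho(f(a),f(b))=0$. -/

import Mathlib

open Filter Set

noncomputable section

namespace SpectralDistance

section Semidistance

variable {A : Type*} [NormedRing A] [NormedAlgebra ℂ A]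

/-- The generalized commutator `C_{a,b} = L_a - R_b`, i.e. `x ↦ a x - x b`, as a bounded
operator on `A`. -/
def commutator (a b : A) : A →L[ℂ] A :=
  ContinuousLinearMap.mul ℂ A a - (ContinuousLinearMap.mul ℂ A).flip b

theorem commutator_apply (a b x : A) : commutator a b x = a * x - x * b := rfl

/-- `ρ(a,b) = limsup_n ‖C_{a,b}^n 1‖^{1/n}`. The sequence is bounded (`C_{a,b}` is a bounded
operator), so that the real `limsup` is the genuine one. -/
def rho (a b : A) : ℝ :=
  limsup (fun n : ℕ => ‖(commutator a b ^ n) 1‖ ^ (1 / (n : ℝ))) atTop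

/-- The spectral (semi)distance `d_ρ(a,b) = max (ρ(a,b), ρ(b,a))`. -/
def dRho (a b : A) : ℝ := max (rho a b) (rho b a)

/-- `a` and `b` are quasinilpotent equivalent. -/
def QuasinilpotentEquivalent (a b : A) : Prop := dRho a b = 0

end Semidistance

/-- A contour: finitely many oriented line segments `[p, q]` in the plane (with multiplicity,
written as pairs `(p, q)`), forming a cycle, that is, every point occurs as often as an initial
point as it occurs as a terminal point. Neither connectedness nor simplicity is asked for. -/
structure Contour where
  segments : Multiset (ℂ × ℂ)
  balanced : segments.map Prod.fst = segments.map Prod.snd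

namespace Contour

/-- The integral `∫_Γ F(z) dz`: the sum of the integrals over the oriented segments, each
parametrized by `z = p + t (q - p)`, `0 ≤ t ≤ 1`. -/
def integral {E : Type*} [NormedAddCommGroup E] [NormedSpace ℂ E] (Γ : Contour) (F : ℂ → E) : E :=
  (Γ.segments.map fun s =>
    ∫ t in (0 : ℝ)..1, (s.2 - s.1) • F (s.1 + (t : ℂ) * (s.2 - s.1))).sum

/-- The index (winding number) `(2πi)⁻¹ ∫_Γ dz / (z - ζ)` of `ζ`. -/
def index (Γ : Contour) (ζ : ℂ) : ℂ :=
  (2 * (Real.pi : ℂ) * Complex.I)⁻¹ * Γ.integral fun z => (z - ζ)⁻¹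

/-- `Γ` surrounds `K` in `U`: the segments of `Γ` lie in `U` and do not meet `K`, and `Γ` has
index `1` about all points of `K` and index `0` about all points outside `U`. -/
structure Surrounds (Γ : Contour) (K U : Set ℂ) : Prop where
  segment_subset : ∀ s ∈ Γ.segments, segment ℝ s.1 s.2 ⊆ U \ K
  index_eq_one : ∀ ζ ∈ K, Γ.index ζ = 1
  index_eq_zero : ∀ ζ ∉ U, Γ.index ζ = 0

end Contour

section FunctionalCalculus

variable {A : Type*} [NormedRing A] [NormedAlgebra ℂ A]

/-- The Riesz-Dunford integral `(2πi)⁻¹ ∫_Γ f(z) (z 1 - a)⁻¹ dz`. -/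
def rieszIntegral (Γ : Contour) (f : ℂ → ℂ) (a : A) : A :=
  (2 * (Real.pi : ℂ) * Complex.I)⁻¹ • Γ.integral fun z => f z • resolvent a z

open Classical in
/-- The element `f(a)` of the holomorphic functional calculus, for `f` holomorphic on the open
set `U ⊇ σ(a)`: the Riesz-Dunford integral over a contour that surrounds `σ(a)` in `U`. Such a
contour always exists, and the value does not depend on it; the `else` branch is never
reached when `U` is open and contains `σ(a)` (and `A` is complete). -/
def holCalc (U : Set ℂ) (f : ℂ → ℂ) (a : A) : A :=
  if h : ∃ Γ : Contour, Γ.Surrounds (spectrum ℂ a) U then rieszIntegral h.choose f a else 0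

/-- The set of numbers whose supremum over `ω ∈ σ(b)` is taken: all `|(f(lam) - f(ω))/(lam - ω)|`
with `ω ∈ σ(b)`, `lam ∈ σ(a)`, `lam ≠ ω`, and all `|f'(ω)|` with `ω ∈ σ(b)`. -/
def quotientSet (f : ℂ → ℂ) (a b : A) : Set ℝ :=
  {r | ∃ ω ∈ spectrum ℂ b,
    (∃ lam ∈ spectrum ℂ a, lam ≠ ω ∧ r = ‖(f lam - f ω) / (lam - ω)‖) ∨ r = ‖deriv f ω‖}

/-- The same, where `|f'(ω)|` is admitted only for `ω ∈ σ(a) ∩ σ(b)` (the case `lam = ω` of the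
difference quotient). -/
def diagonalQuotientSet (f : ℂ → ℂ) (a b : A) : Set ℝ :=
  {r | ∃ ω ∈ spectrum ℂ b, ∃ lam ∈ spectrum ℂ a,
    (lam ≠ ω ∧ r = ‖(f lam - f ω) / (lam - ω)‖) ∨ (lam = ω ∧ r = ‖deriv f ω‖)}

end FunctionalCalculus

end SpectralDistance

end

noncomputable section

namespace SpectralDistance

open MeasureTheory Topology WeakDual

/-! The operator `commutator a b` is `L_a - R_b`, where left multiplication `L_a` and right
multiplication `R_b` commute in the Banach algebra of bounded operators on `A`. The Riesz integrals
pass through, so `L_{f(a)} = f(L_a)` and `R_{f(b)} = f(R_b)`. Inside the bicommutant of `L_a` and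
`R_b`, a commutative Banach algebra, the resolvent identity gives `f(L_a) - f(R_b) = g (L_a - R_b)`
with `g = (2πi)⁻¹ ∫ f(z) (z - L_a)⁻¹ (z - R_b)⁻¹ dz`. A character `χ` sends `g` to the divided
difference of `f` at `χ(L_a) ∈ σ(a)` and `χ(R_b) ∈ σ(b)`, so the spectral radius of `g` is at most
the supremum `M` of these. As `g` commutes with `L_a - R_b`, the n-th iterate at `1` for `f(a),
f(b)` is `g^n` applied to the one for `a, b`; taking roots yields the factor `M` (`rho_holCalc_le`).

The contours behind `f(a)` and `f(b)` are arbitrary and unrelated, whereas `g` needs a single one.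
`exists_surrounds` builds, from a square grid, a contour around any compact subset of `U` over which
functions holomorphic on `U` integrate to zero. Drawn around the compact hulls of both given
contours, it yields the same elements by Fubini and the resolvent identity
(`rieszIntegral_eq_of_surrounds_hull`), without a homological Cauchy theorem for the given contours.

For the equality of spectra, off `σ(b)` the series `∑ C_{a,b}^n(1) (z - b)^{-n-1}` converges when
`ρ(a,b) = 0` and is a right inverse of `z - a`; a mirrored series using `ρ(b,a) = 0` is a left
inverse. The rest of (2) is (1) applied in both orders. -/

/-- The integral over one oriented segment. -/
def segIntegral {E : Type*} [NormedAddCommGroup E] [NormedSpace ℂ E] (s : ℂ × ℂ) (F : ℂ → E) : E :=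
  ∫ t in (0 : ℝ)..1, (s.2 - s.1) • F (s.1 + (t : ℂ) * (s.2 - s.1))

/-! ### Integration along an oriented segment -/

section Segment

variable {E : Type*} [NormedAddCommGroup E] [NormedSpace ℂ E]

theorem add_mul_sub_mem_segment (s : ℂ × ℂ) {t : ℝ} (ht : t ∈ Icc (0 : ℝ) 1) :
    s.1 + (t : ℂ) * (s.2 - s.1) ∈ segment ℝ s.1 s.2 := by
  rw [segment_eq_image']
  exact ⟨t, ht, by simp⟩

theorem continuous_segment_param (s : ℂ × ℂ) :
    Continuous fun t : ℝ => s.1 + (t : ℂ) * (s.2 - s.1) := by fun_prop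

theorem continuousOn_segment_integrand {s : ℂ × ℂ} {F : ℂ → E}
    (hF : ContinuousOn F (segment ℝ s.1 s.2)) :
    ContinuousOn (fun t : ℝ => (s.2 - s.1) • F (s.1 + (t : ℂ) * (s.2 - s.1))) (Icc 0 1) :=
  (hF.comp (continuous_segment_param s).continuousOn
    fun _ ht => add_mul_sub_mem_segment s ht).const_smul _

theorem intervalIntegrable_segment_integrand {s : ℂ × ℂ} {F : ℂ → E}
    (hF : ContinuousOn F (segment ℝ s.1 s.2)) :
    IntervalIntegrable (fun t : ℝ => (s.2 - s.1) • F (s.1 + (t : ℂ) * (s.2 - s.1))) volume 0 1 := by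
  apply ContinuousOn.intervalIntegrable
  rw [uIcc_of_le zero_le_one]
  exact continuousOn_segment_integrand hF

theorem segIntegral_congr {s : ℂ × ℂ} {F G : ℂ → E}
    (h : ∀ z ∈ segment ℝ s.1 s.2, F z = G z) : segIntegral s F = segIntegral s G := by
  apply intervalIntegral.integral_congr
  intro t ht
  rw [uIcc_of_le zero_le_one] at ht
  simp only [h _ (add_mul_sub_mem_segment s ht)]

theorem segIntegral_add {s : ℂ × ℂ} {F G : ℂ → E} (hF : ContinuousOn F (segment ℝ s.1 s.2))
    (hG : ContinuousOn G (segment ℝ s.1 s.2)) :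
    segIntegral s (fun z => F z + G z) = segIntegral s F + segIntegral s G := by
  simp only [segIntegral, smul_add]
  exact intervalIntegral.integral_add (intervalIntegrable_segment_integrand hF)
    (intervalIntegrable_segment_integrand hG)

theorem segIntegral_clm {E' : Type*} [NormedAddCommGroup E'] [NormedSpace ℂ E'] [CompleteSpace E]
    [CompleteSpace E'] (L : E →L[ℂ] E') {s : ℂ × ℂ} {F : ℂ → E}
    (hF : ContinuousOn F (segment ℝ s.1 s.2)) :
    segIntegral s (fun z => L (F z)) = L (segIntegral s F) := by
  simp only [segIntegral, ← map_smul]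
  exact L.intervalIntegral_comp_comm (intervalIntegrable_segment_integrand hF)

theorem segIntegral_swap (s : ℂ × ℂ) (F : ℂ → E) :
    segIntegral s.swap F = -segIntegral s F := by
  have h := intervalIntegral.integral_comp_sub_left
    (fun t : ℝ => (s.2 - s.1) • F (s.1 + (t : ℂ) * (s.2 - s.1))) (a := 0) (b := 1) 1
  simp only [sub_self, sub_zero] at h
  unfold segIntegral
  rw [← h, ← intervalIntegral.integral_neg]
  congr 1
  ext t
  rw [← neg_smul]
  simp only [Prod.fst_swap, Prod.snd_swap]
  congr 1
  · ring
  · congr 1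
    push_cast
    ring

theorem segIntegral_eq_sub [CompleteSpace E] {s : ℂ × ℂ} {F F' : ℂ → E}
    (h : ∀ z ∈ segment ℝ s.1 s.2, HasDerivAt F (F' z) z)
    (hc : ContinuousOn F' (segment ℝ s.1 s.2)) : segIntegral s F' = F s.2 - F s.1 := by
  have := intervalIntegral.integral_eq_sub_of_hasDerivAt
    (f := fun t : ℝ => F (s.1 + (t : ℂ) * (s.2 - s.1))) (a := 0) (b := 1)
    (f' := fun t : ℝ => (s.2 - s.1) • F' (s.1 + (t : ℂ) * (s.2 - s.1)))
    (fun t ht => by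
      rw [uIcc_of_le zero_le_one] at ht
      have h1 : HasDerivAt (fun t : ℝ => s.1 + (t : ℂ) * (s.2 - s.1)) (s.2 - s.1) t := by
        simpa using ((Complex.ofRealCLM.hasDerivAt (x := t)).mul_const (s.2 - s.1)).const_add s.1
      exact (h _ (add_mul_sub_mem_segment s ht)).scomp t h1)
    (intervalIntegrable_segment_integrand hc)
  simpa [segIntegral] using this

theorem norm_segIntegral_le {s : ℂ × ℂ} {F : ℂ → E} {C : ℝ}
    (h : ∀ z ∈ segment ℝ s.1 s.2, ‖F z‖ ≤ C) : ‖segIntegral s F‖ ≤ ‖s.2 - s.1‖ * C := by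
  have := intervalIntegral.norm_integral_le_of_norm_le_const (a := 0) (b := 1)
    (f := fun t : ℝ => (s.2 - s.1) • F (s.1 + (t : ℂ) * (s.2 - s.1))) (C := ‖s.2 - s.1‖ * C)
    (fun t ht => by
      rw [uIoc_of_le zero_le_one] at ht
      rw [norm_smul]
      exact mul_le_mul_of_nonneg_left (h _ (add_mul_sub_mem_segment s ⟨ht.1.le, ht.2⟩))
        (norm_nonneg _))
  simpa [segIntegral] using this

theorem integrableOn_segment_prod {s s' : ℂ × ℂ} {F : ℂ → ℂ → E}
    (hF : ContinuousOn (Function.uncurry F) (segment ℝ s.1 s.2 ×ˢ segment ℝ s'.1 s'.2)) :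
    IntegrableOn (Function.uncurry fun t t' : ℝ => (s.2 - s.1) • (s'.2 - s'.1) •
        F (s.1 + (t : ℂ) * (s.2 - s.1)) (s'.1 + (t' : ℂ) * (s'.2 - s'.1)))
      (uIoc (0 : ℝ) 1 ×ˢ uIoc (0 : ℝ) 1) := by
  have hc : ContinuousOn (Function.uncurry fun t t' : ℝ => (s.2 - s.1) • (s'.2 - s'.1) •
        F (s.1 + (t : ℂ) * (s.2 - s.1)) (s'.1 + (t' : ℂ) * (s'.2 - s'.1)))
        (Icc (0 : ℝ) 1 ×ˢ Icc (0 : ℝ) 1) := by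
    have h1 : ContinuousOn (fun p : ℝ × ℝ => Function.uncurry F
        (s.1 + (p.1 : ℂ) * (s.2 - s.1), s'.1 + (p.2 : ℂ) * (s'.2 - s'.1)))
        (Icc (0 : ℝ) 1 ×ˢ Icc (0 : ℝ) 1) :=
      hF.comp (by fun_prop) fun p hp =>
        ⟨add_mul_sub_mem_segment s hp.1, add_mul_sub_mem_segment s' hp.2⟩
    exact (h1.const_smul (s'.2 - s'.1)).const_smul (s.2 - s.1)
  have := hc.integrableOn_compact (μ := (volume : Measure (ℝ × ℝ)))
    (isCompact_Icc.prod isCompact_Icc)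
  refine IntegrableOn.mono_set this ?_
  rw [uIoc_of_le zero_le_one]
  exact prod_mono Ioc_subset_Icc_self Ioc_subset_Icc_self

theorem segIntegral_segIntegral_swap {s s' : ℂ × ℂ} {F : ℂ → ℂ → E}
    (hF : ContinuousOn (Function.uncurry F) (segment ℝ s.1 s.2 ×ˢ segment ℝ s'.1 s'.2)) :
    segIntegral s (fun z => segIntegral s' fun w => F z w) =
      segIntegral s' (fun w => segIntegral s fun z => F z w) := by
  simp only [segIntegral, ← intervalIntegral.integral_smul]
  rw [intervalIntegral_intervalIntegral_swap (integrableOn_segment_prod hF)]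
  simp only [smul_comm (s.2 - s.1)]

theorem intervalIntegrable_segIntegral {s s' : ℂ × ℂ} {F : ℂ → ℂ → E}
    (hF : ContinuousOn (Function.uncurry F) (segment ℝ s.1 s.2 ×ˢ segment ℝ s'.1 s'.2)) :
    IntervalIntegrable (fun t : ℝ => (s.2 - s.1) •
      segIntegral s' fun w => F (s.1 + (t : ℂ) * (s.2 - s.1)) w) volume 0 1 := by
  simp only [segIntegral, ← intervalIntegral.integral_smul]
  have := integrableOn_segment_prod hF
  rw [IntegrableOn, Measure.volume_eq_prod, ← Measure.prod_restrict] at this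
  replace this := this.integral_prod_left
  simp only [Function.uncurry] at this
  simp only [intervalIntegral.integral_of_le zero_le_one, intervalIntegrable_iff, IntegrableOn]
  rw [uIoc_of_le zero_le_one] at this ⊢
  exact this

end Segment

/-! ### Integration along cycles -/

namespace Contour

variable {E : Type*} [NormedAddCommGroup E] [NormedSpace ℂ E] (Γ : Contour)

/-- The union of the segments of a contour. -/
def trace : Set ℂ := ⋃ s ∈ {s | s ∈ Γ.segments}, segment ℝ s.1 s.2

theorem segment_subset_trace {s : ℂ × ℂ} (hs : s ∈ Γ.segments) :
    segment ℝ s.1 s.2 ⊆ Γ.trace :=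
  subset_biUnion_of_mem (u := fun s : ℂ × ℂ => segment ℝ s.1 s.2) hs

theorem isCompact_trace : IsCompact Γ.trace := by
  refine (Multiset.finite_toSet Γ.segments).isCompact_biUnion fun s _ => ?_
  rw [segment_eq_image']
  exact isCompact_Icc.image (by fun_prop)

theorem integral_eq (F : ℂ → E) :
    Γ.integral F = (Γ.segments.map fun s => segIntegral s F).sum := rfl

variable {Γ}

theorem integral_congr {F G : ℂ → E} (h : ∀ z ∈ Γ.trace, F z = G z) :
    Γ.integral F = Γ.integral G := by
  rw [integral_eq, integral_eq]
  congr 1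
  exact Multiset.map_congr rfl fun s hs =>
    segIntegral_congr fun z hz => h z (Γ.segment_subset_trace hs hz)

theorem integral_add {F G : ℂ → E} (hF : ContinuousOn F Γ.trace) (hG : ContinuousOn G Γ.trace) :
    Γ.integral (fun z => F z + G z) = Γ.integral F + Γ.integral G := by
  rw [integral_eq, integral_eq, integral_eq, ← Multiset.sum_map_add]
  congr 1
  exact Multiset.map_congr rfl fun s hs =>
    segIntegral_add (hF.mono (Γ.segment_subset_trace hs)) (hG.mono (Γ.segment_subset_trace hs))

theorem integral_clm {E' : Type*} [NormedAddCommGroup E'] [NormedSpace ℂ E'] [CompleteSpace E]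
    [CompleteSpace E'] (L : E →L[ℂ] E') {F : ℂ → E} (hF : ContinuousOn F Γ.trace) :
    Γ.integral (fun z => L (F z)) = L (Γ.integral F) := by
  rw [integral_eq, integral_eq, map_multiset_sum, Multiset.map_map]
  congr 1
  exact Multiset.map_congr rfl fun s hs =>
    segIntegral_clm L (hF.mono (Γ.segment_subset_trace hs))

theorem integral_const_smul [CompleteSpace E] (c : ℂ) {F : ℂ → E} (hF : ContinuousOn F Γ.trace) :
    Γ.integral (fun z => c • F z) = c • Γ.integral F :=
  integral_clm (c • ContinuousLinearMap.id ℂ E) hF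

theorem integral_sub [CompleteSpace E] {F G : ℂ → E} (hF : ContinuousOn F Γ.trace)
    (hG : ContinuousOn G Γ.trace) :
    Γ.integral (fun z => F z - G z) = Γ.integral F - Γ.integral G := by
  have h := integral_add (G := fun z => (-1 : ℂ) • G z) hF (hG.const_smul (-1 : ℂ))
  rw [integral_const_smul _ hG] at h
  simpa [sub_eq_add_neg] using h

theorem integral_smul_const [CompleteSpace E] {F : ℂ → ℂ} (hF : ContinuousOn F Γ.trace) (x : E) :
    Γ.integral (fun z => F z • x) = Γ.integral F • x :=
  integral_clm ((ContinuousLinearMap.id ℂ ℂ).smulRight x) hF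

theorem segIntegral_integral {s : ℂ × ℂ} {F : ℂ → ℂ → E}
    (hF : ContinuousOn (Function.uncurry F) (segment ℝ s.1 s.2 ×ˢ Γ.trace)) :
    segIntegral s (fun z => Γ.integral fun w => F z w) =
      Γ.integral (fun w => segIntegral s fun z => F z w) := by
  -- Integrability of the outer integrand is carried through the induction, since additivity of the
  -- integral needs it at each step.
  have key : ∀ m : Multiset (ℂ × ℂ), m ≤ Γ.segments →
      IntervalIntegrable (fun t : ℝ => (s.2 - s.1) • (m.map fun s' => segIntegral s' fun w =>
        F (s.1 + (t : ℂ) * (s.2 - s.1)) w).sum) volume 0 1 ∧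
      segIntegral s (fun z => (m.map fun s' => segIntegral s' fun w => F z w).sum) =
        (m.map fun s' => segIntegral s' fun w => segIntegral s fun z => F z w).sum := by
    intro m
    induction m using Multiset.induction with
    | empty => simp [segIntegral]
    | cons s' m ih =>
      intro hm
      obtain ⟨ih1, ih2⟩ := ih ((Multiset.le_cons_self m s').trans hm)
      have hF' := hF.mono (prod_mono subset_rfl
        (Γ.segment_subset_trace (Multiset.subset_of_le hm (Multiset.mem_cons_self s' m))))
      have h1 := intervalIntegrable_segIntegral hF'
      simp only [Multiset.map_cons, Multiset.sum_cons, smul_add]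
      refine ⟨h1.add ih1, ?_⟩
      rw [← segIntegral_segIntegral_swap hF', ← ih2]
      exact (congrArg (fun g : ℝ → E => ∫ t in (0 : ℝ)..1, g t) (funext fun t => smul_add _ _ _)).trans
        (intervalIntegral.integral_add h1 ih1)
  exact (key _ le_rfl).2

theorem integral_integral_swap {Γ' : Contour} {F : ℂ → ℂ → E}
    (hF : ContinuousOn (Function.uncurry F) (Γ.trace ×ˢ Γ'.trace)) :
    Γ.integral (fun z => Γ'.integral fun w => F z w) =
      Γ'.integral (fun w => Γ.integral fun z => F z w) := by
  have h : ∀ s ∈ Γ.segments, segIntegral s (fun z => Γ'.integral fun w => F z w) =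
      Γ'.integral (fun w => segIntegral s fun z => F z w) := fun s hs =>
    segIntegral_integral (hF.mono (prod_mono (Γ.segment_subset_trace hs) subset_rfl))
  have h' : ∀ s' ∈ Γ'.segments, segIntegral s' (fun w => Γ.integral fun z => F z w) =
      (Γ.segments.map fun s => segIntegral s' fun w => segIntegral s fun z => F z w).sum := by
    intro s' hs'
    have hF' : ContinuousOn (Function.uncurry fun w z => F z w) (segment ℝ s'.1 s'.2 ×ˢ Γ.trace) :=
      (hF.mono (prod_mono subset_rfl (Γ'.segment_subset_trace hs'))).comp
        continuous_swap.continuousOn fun p hp => ⟨hp.2, hp.1⟩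
    rw [segIntegral_integral hF', integral_eq]
    congr 1
    refine Multiset.map_congr rfl fun s hs => ?_
    exact segIntegral_segIntegral_swap (hF.mono (prod_mono (Γ.segment_subset_trace hs)
        (Γ'.segment_subset_trace hs')))
  rw [integral_eq, Multiset.map_congr rfl h, integral_eq (Γ := Γ'), Multiset.map_congr rfl h']
  exact Multiset.sum_map_sum_map _ _

theorem exists_norm_integral_le (Γ : Contour) : ∃ C : ℝ, ∀ (F : ℂ → ℂ) (M : ℝ),
    (∀ z ∈ Γ.trace, ‖F z‖ ≤ M) → ‖Γ.integral F‖ ≤ C * M := by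
  refine ⟨(Γ.segments.map fun s => ‖s.2 - s.1‖).sum, fun F M h => ?_⟩
  have key : ∀ m : Multiset (ℂ × ℂ), m ≤ Γ.segments →
      ‖(m.map fun s => segIntegral s F).sum‖ ≤ (m.map fun s => ‖s.2 - s.1‖).sum * M := by
    intro m
    induction m using Multiset.induction with
    | empty => simp
    | cons s m ih =>
      intro hm
      have h1 := ih ((Multiset.le_cons_self m s).trans hm)
      have h2 := norm_segIntegral_le (s := s) (F := F) (C := M) fun z hz => h z
        (Γ.segment_subset_trace (Multiset.subset_of_le hm (Multiset.mem_cons_self s m)) hz)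
      simp only [Multiset.map_cons, Multiset.sum_cons, add_mul]
      exact (norm_add_le _ _).trans (add_le_add h2 h1)
  exact key _ le_rfl

/-- A cycle integrates exact integrands to zero. -/
theorem integral_eq_zero_of_hasDerivAt [CompleteSpace E] {F F' : ℂ → E}
    (h : ∀ z ∈ Γ.trace, HasDerivAt F (F' z) z) (hc : ContinuousOn F' Γ.trace) :
    Γ.integral F' = 0 := by
  rw [integral_eq, Multiset.map_congr rfl fun s hs => segIntegral_eq_sub
    (fun z hz => h z (Γ.segment_subset_trace hs hz)) (hc.mono (Γ.segment_subset_trace hs)),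
    Multiset.sum_map_sub]
  -- The increments of `F` cancel in total, because initial and terminal points agree as multisets.
  have h2 := congrArg (fun m : Multiset ℂ => (m.map F).sum) Γ.balanced
  simp only [Multiset.map_map, Function.comp_apply] at h2
  rw [sub_eq_zero, h2]

end Contour

/-! ### The index: integrality, local constancy, compact hull -/

theorem ratio_mem_slitPlane {p q w z : ℂ} (hw : w ∉ segment ℝ p q) (hz : z ∈ segment ℝ p q) :
    (z - w) / (p - w) ∈ Complex.slitPlane := by
  have hp : p - w ≠ 0 := fun h => hw (by
    rw [← sub_eq_zero.1 h]; exact left_mem_segment ℝ p q)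
  by_contra hn
  rw [Complex.mem_slitPlane_iff_not_le_zero, not_not] at hn
  obtain ⟨r, hr, hr'⟩ : ∃ r : ℝ, 0 ≤ r ∧ (z - w) / (p - w) = -(r : ℂ) := by
    refine ⟨-((z - w) / (p - w)).re, ?_, ?_⟩
    · have := (Complex.le_def.1 hn).1
      simpa using this
    · have := (Complex.le_def.1 hn).2
      apply Complex.ext <;> simp_all
  rw [div_eq_iff hp] at hr'
  apply hw
  have hc : (1 + (r : ℂ)) ≠ 0 := by
    have : (1 + r : ℝ) ≠ 0 := by positivity
    exact_mod_cast this
  -- Solving `z - w = -r (p - w)` for `w` makes it a convex combination of `p` and `z`, hence a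
  -- point of the segment.
  have hwz : w = (r / (1 + r) : ℝ) • p + (1 / (1 + r) : ℝ) • z := by
    simp only [Complex.real_smul]
    push_cast
    field_simp
    linear_combination -hr'
  rw [hwz]
  exact (convex_segment p q) (left_mem_segment ℝ p q) hz (by positivity) (by positivity)
    (by field_simp; ring)

/-- Dividing by `s.1 - w` keeps the argument of the logarithm off the branch cut along the whole
segment and makes the primitive vanish at the initial point. -/
theorem segIntegral_inv_sub {s : ℂ × ℂ} {w : ℂ} (hw : w ∉ segment ℝ s.1 s.2) :
    segIntegral s (fun z => (z - w)⁻¹) = Complex.log ((s.2 - w) / (s.1 - w)) := by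
  have hne : ∀ z ∈ segment ℝ s.1 s.2, z - w ≠ 0 := fun z hz h => hw (by rwa [← sub_eq_zero.1 h])
  have hp := hne _ (left_mem_segment ℝ s.1 s.2)
  rw [segIntegral_eq_sub (F := fun z => Complex.log ((z - w) / (s.1 - w)))]
  · simp [div_self hp]
  · intro z hz
    have h1 : HasDerivAt (fun z : ℂ => (z - w) / (s.1 - w)) (1 / (s.1 - w)) z :=
      ((hasDerivAt_id z).sub_const w).div_const _
    have h2 := h1.clog (ratio_mem_slitPlane hw hz)
    rwa [div_div_div_cancel_right₀ hp, one_div] at h2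
  · exact (continuousOn_id.sub continuousOn_const).inv₀ hne

namespace Contour

variable {Γ : Contour}

theorem sub_ne_zero_of_notMem_trace {w : ℂ} (hw : w ∉ Γ.trace) :
    ∀ z ∈ Γ.trace, z - w ≠ 0 := fun z hz h => hw (by rwa [← sub_eq_zero.1 h])

theorem index_eq_sum_log {w : ℂ} (hw : w ∉ Γ.trace) :
    Γ.index w = (2 * (Real.pi : ℂ) * Complex.I)⁻¹ *
      (Γ.segments.map fun s => Complex.log ((s.2 - w) / (s.1 - w))).sum := by
  rw [index, integral_eq, Multiset.map_congr rfl fun s hs =>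
    segIntegral_inv_sub fun h => hw (Γ.segment_subset_trace hs h)]

/-- The exponential of the sum of logarithms is the product of the ratios `(q - w) / (p - w)`, which
is `1` because the cycle is balanced. -/
theorem exists_index_eq_intCast {w : ℂ} (hw : w ∉ Γ.trace) : ∃ n : ℤ, Γ.index w = n := by
  have hne : ∀ s ∈ Γ.segments, s.1 - w ≠ 0 ∧ s.2 - w ≠ 0 := fun s hs =>
    ⟨sub_ne_zero_of_notMem_trace hw _ (Γ.segment_subset_trace hs (left_mem_segment ℝ _ _)),
      sub_ne_zero_of_notMem_trace hw _ (Γ.segment_subset_trace hs (right_mem_segment ℝ _ _))⟩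
  have h1 : Complex.exp (Γ.segments.map fun s => Complex.log ((s.2 - w) / (s.1 - w))).sum = 1 := by
    rw [Complex.exp_multiset_sum, Multiset.map_map]
    rw [Multiset.map_congr (g := fun s : ℂ × ℂ => (s.2 - w) / (s.1 - w)) rfl fun s hs => by
      have := hne s hs
      exact Complex.exp_log (div_ne_zero this.2 this.1)]
    rw [Multiset.prod_map_div]
    have h2 := congrArg (fun m : Multiset ℂ => (m.map fun z => z - w).prod) Γ.balanced
    simp only [Multiset.map_map, Function.comp_apply] at h2
    rw [← h2, div_self]
    rw [Ne, Multiset.prod_eq_zero_iff, Multiset.mem_map]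
    rintro ⟨s, hs, h⟩
    exact (hne s hs).1 h
  obtain ⟨n, hn⟩ := Complex.exp_eq_one_iff.1 h1
  refine ⟨n, ?_⟩
  rw [index_eq_sum_log hw, hn]
  field_simp [Complex.two_pi_I_ne_zero]

theorem continuousAt_index {w : ℂ} (hw : w ∉ Γ.trace) : ContinuousAt Γ.index w := by
  have hopen : ∀ᶠ z in 𝓝 w, z ∉ Γ.trace := Γ.isCompact_trace.isClosed.isOpen_compl.mem_nhds hw
  have : ContinuousAt (fun w => (2 * (Real.pi : ℂ) * Complex.I)⁻¹ *
      (Γ.segments.map fun s => Complex.log ((s.2 - w) / (s.1 - w))).sum) w := by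
    refine ContinuousAt.mul continuousAt_const (tendsto_multiset_sum _ fun s hs => ?_)
    have hws : w ∉ segment ℝ s.1 s.2 := fun h => hw (Γ.segment_subset_trace hs h)
    have hp : s.1 - w ≠ 0 := sub_ne_zero_of_notMem_trace hw _
      (Γ.segment_subset_trace hs (left_mem_segment ℝ _ _))
    refine ContinuousAt.clog ?_ (ratio_mem_slitPlane hws (right_mem_segment ℝ _ _))
    exact (continuousAt_const.sub continuousAt_id).div (continuousAt_const.sub continuousAt_id) hp
  exact this.congr (hopen.mono fun z hz => (index_eq_sum_log hz).symm)

theorem tendsto_index_cocompact : Tendsto Γ.index (cocompact ℂ) (𝓝 0) := by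
  have hev : ∀ᶠ z in cocompact ℂ, z ∉ Γ.trace := Γ.isCompact_trace.compl_mem_cocompact
  have hlim : Tendsto (fun w => (2 * (Real.pi : ℂ) * Complex.I)⁻¹ *
      (Γ.segments.map fun s => Complex.log ((s.2 - w) / (s.1 - w))).sum) (cocompact ℂ)
      (𝓝 ((2 * (Real.pi : ℂ) * Complex.I)⁻¹ * (Γ.segments.map fun _ => (0 : ℂ)).sum)) := by
    refine Tendsto.mul tendsto_const_nhds (tendsto_multiset_sum _ fun s hs => ?_)
    have h1 : Tendsto (fun w : ℂ => (s.1 - w)⁻¹) (cocompact ℂ) (𝓝 0) :=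
      tendsto_inv₀_cobounded.comp (by
        rw [← Metric.cobounded_eq_cocompact]
        exact tendsto_const_sub_cobounded s.1)
    have h2 : Tendsto (fun w : ℂ => 1 + (s.2 - s.1) * (s.1 - w)⁻¹) (cocompact ℂ) (𝓝 1) := by
      simpa using (h1.const_mul (s.2 - s.1)).const_add 1
    have h3 : Tendsto (fun w : ℂ => Complex.log (1 + (s.2 - s.1) * (s.1 - w)⁻¹))
        (cocompact ℂ) (𝓝 0) := by
      have := (continuousAt_clog Complex.one_mem_slitPlane).tendsto.comp h2
      simpa [Function.comp_def] using this
    refine h3.congr' (hev.mono fun w hw => ?_)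
    have hp : s.1 - w ≠ 0 := sub_ne_zero_of_notMem_trace hw _
      (Γ.segment_subset_trace hs (left_mem_segment ℝ _ _))
    congr 1
    field_simp
    ring
  simp only [Multiset.map_const', Multiset.sum_replicate, smul_zero, mul_zero] at hlim
  exact hlim.congr' (hev.mono fun z hz => (index_eq_sum_log hz).symm)

theorem index_eq_of_norm_sub_lt {z w : ℂ} (hz : z ∉ Γ.trace) {n : ℤ} (hn : (n : ℂ) = w)
    (h : ‖Γ.index z - w‖ < 1) : Γ.index z = w := by
  obtain ⟨m, hm⟩ := exists_index_eq_intCast hz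
  rw [hm, ← hn] at h ⊢
  rw [← Int.cast_sub, Complex.norm_intCast] at h
  have : |m - n| < 1 := by exact_mod_cast h
  rw [Int.abs_lt_one_iff, sub_eq_zero] at this
  rw [this]

theorem eventually_index_eq {w : ℂ} (hw : w ∉ Γ.trace) : ∀ᶠ z in 𝓝 w, Γ.index z = Γ.index w := by
  obtain ⟨n, hn⟩ := exists_index_eq_intCast hw
  have h1 := (continuousAt_index hw).tendsto.eventually (Metric.ball_mem_nhds _ one_pos)
  have hopen : ∀ᶠ z in 𝓝 w, z ∉ Γ.trace := Γ.isCompact_trace.isClosed.isOpen_compl.mem_nhds hw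
  filter_upwards [h1, hopen] with z hz hz'
  exact index_eq_of_norm_sub_lt hz' hn.symm (by simpa [dist_eq_norm] using hz)

/-- The trace together with the points about which the contour winds. -/
def hull (Γ : Contour) : Set ℂ := Γ.trace ∪ {w | Γ.index w ≠ 0}

/-- Closed because the index is locally constant off the trace, bounded because it is an integer
tending to `0` at infinity. Compactness lets a further contour be drawn around everything that `Γ`
encloses. -/
theorem isCompact_hull (Γ : Contour) : IsCompact Γ.hull := by
  have hclosed : IsClosed Γ.hull := by
    rw [← isOpen_compl_iff, isOpen_iff_mem_nhds]
    intro w hw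
    simp only [hull, mem_compl_iff, mem_union, mem_ofPred_eq, not_or, not_not] at hw
    have hopen : ∀ᶠ z in 𝓝 w, z ∉ Γ.trace :=
      Γ.isCompact_trace.isClosed.isOpen_compl.mem_nhds hw.1
    filter_upwards [hopen, eventually_index_eq hw.1] with z hz hz'
    simp [hull, hz, hz', hw.2]
  have hcoc : Γ.hullᶜ ∈ cocompact ℂ := by
    have h1 := tendsto_index_cocompact (Γ := Γ) |>.eventually (Metric.ball_mem_nhds _ one_pos)
    have hev : ∀ᶠ z in cocompact ℂ, z ∉ Γ.trace := Γ.isCompact_trace.compl_mem_cocompact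
    filter_upwards [h1, hev] with z hz hz'
    have : Γ.index z = 0 := index_eq_of_norm_sub_lt hz' Int.cast_zero (by simpa using hz)
    simp [hull, hz', this]
  obtain ⟨t, ht, hts⟩ := mem_cocompact.1 hcoc
  exact ht.of_isClosed_subset hclosed (compl_subset_compl.1 hts)

theorem Surrounds.trace_subset {K U : Set ℂ} (h : Γ.Surrounds K U) : Γ.trace ⊆ U \ K :=
  iUnion₂_subset h.segment_subset

theorem Surrounds.hull_subset {K U : Set ℂ} (h : Γ.Surrounds K U) : Γ.hull ⊆ U := by
  rintro w (hw | hw)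
  · exact (h.trace_subset hw).1
  · by_contra hn
    exact hw (h.index_eq_zero w hn)

theorem Surrounds.subset_hull {K U : Set ℂ} (h : Γ.Surrounds K U) : K ⊆ Γ.hull := fun w hw =>
  Or.inr (by simp [h.index_eq_one w hw])

theorem Surrounds.mono {K K' U : Set ℂ} (h : Γ.Surrounds K U) (hK : K' ⊆ K) : Γ.Surrounds K' U where
  segment_subset s hs := (h.segment_subset s hs).trans (sdiff_subset_sdiff_right hK)
  index_eq_one ζ hζ := h.index_eq_one ζ (hK hζ)
  index_eq_zero := h.index_eq_zero

end Contour

/-! ### Contours made of edges of a square grid -/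

namespace Grid

/-- The vertex `δ (i + j I)` of the square grid of mesh `δ`. -/
def vertex (δ : ℝ) (i j : ℤ) : ℂ := ⟨i * δ, j * δ⟩

/-- The closed cell of the grid with lower left vertex `vertex δ c.1 c.2`. -/
def cell (δ : ℝ) (c : ℤ × ℤ) : Set ℂ :=
  Icc (c.1 * δ) ((c.1 + 1) * δ) ×ℂ Icc (c.2 * δ) ((c.2 + 1) * δ)

def bottom (δ : ℝ) (c : ℤ × ℤ) : ℂ × ℂ := (vertex δ c.1 c.2, vertex δ (c.1 + 1) c.2)

def right (δ : ℝ) (c : ℤ × ℤ) : ℂ × ℂ := (vertex δ (c.1 + 1) c.2, vertex δ (c.1 + 1) (c.2 + 1))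

def top (δ : ℝ) (c : ℤ × ℤ) : ℂ × ℂ := (vertex δ (c.1 + 1) (c.2 + 1), vertex δ c.1 (c.2 + 1))

def left (δ : ℝ) (c : ℤ × ℤ) : ℂ × ℂ := (vertex δ c.1 (c.2 + 1), vertex δ c.1 c.2)

theorem top_eq_swap (δ : ℝ) (c : ℤ × ℤ) : top δ c = (bottom δ (c + (0, 1))).swap := by
  simp [top, bottom]

theorem right_eq_swap (δ : ℝ) (c : ℤ × ℤ) : right δ c = (left δ (c + (1, 0))).swap := by
  simp [right, left]

theorem convex_cell (δ : ℝ) (c : ℤ × ℤ) : Convex ℝ (cell δ c) :=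
  ((convex_Icc _ _).is_linear_preimage Complex.reLm.isLinear).inter
    ((convex_Icc _ _).is_linear_preimage Complex.imLm.isLinear)

variable {δ : ℝ}

theorem vertex_mem_cell (hδ : 0 < δ) {i j : ℤ} {c : ℤ × ℤ} (hi : i = c.1 ∨ i = c.1 + 1)
    (hj : j = c.2 ∨ j = c.2 + 1) : vertex δ i j ∈ cell δ c := by
  rw [cell, Complex.mem_reProdIm]
  rcases hi with rfl | rfl <;> rcases hj with rfl | rfl <;>
    simp only [vertex, mem_Icc] <;> push_cast <;> refine ⟨⟨?_, ?_⟩, ⟨?_, ?_⟩⟩ <;> nlinarith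

theorem bottom_subset_cell (hδ : 0 < δ) (c : ℤ × ℤ) :
    segment ℝ (bottom δ c).1 (bottom δ c).2 ⊆ cell δ c :=
  (convex_cell δ c).segment_subset (vertex_mem_cell hδ (by simp) (by simp))
    (vertex_mem_cell hδ (by simp) (by simp))

theorem right_subset_cell (hδ : 0 < δ) (c : ℤ × ℤ) :
    segment ℝ (right δ c).1 (right δ c).2 ⊆ cell δ c :=
  (convex_cell δ c).segment_subset (vertex_mem_cell hδ (by simp) (by simp))
    (vertex_mem_cell hδ (by simp) (by simp))

theorem top_subset_cell (hδ : 0 < δ) (c : ℤ × ℤ) :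
    segment ℝ (top δ c).1 (top δ c).2 ⊆ cell δ c :=
  (convex_cell δ c).segment_subset (vertex_mem_cell hδ (by simp) (by simp))
    (vertex_mem_cell hδ (by simp) (by simp))

theorem left_subset_cell (hδ : 0 < δ) (c : ℤ × ℤ) :
    segment ℝ (left δ c).1 (left δ c).2 ⊆ cell δ c :=
  (convex_cell δ c).segment_subset (vertex_mem_cell hδ (by simp) (by simp))
    (vertex_mem_cell hδ (by simp) (by simp))

theorem bottom_subset_cell_below (hδ : 0 < δ) (c : ℤ × ℤ) :
    segment ℝ (bottom δ c).1 (bottom δ c).2 ⊆ cell δ (c - (0, 1)) :=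
  (convex_cell δ _).segment_subset (vertex_mem_cell hδ (by simp) (by simp))
    (vertex_mem_cell hδ (by simp) (by simp))

theorem right_subset_cell_right (hδ : 0 < δ) (c : ℤ × ℤ) :
    segment ℝ (right δ c).1 (right δ c).2 ⊆ cell δ (c + (1, 0)) :=
  (convex_cell δ _).segment_subset (vertex_mem_cell hδ (by simp) (by simp))
    (vertex_mem_cell hδ (by simp) (by simp))

theorem top_subset_cell_above (hδ : 0 < δ) (c : ℤ × ℤ) :
    segment ℝ (top δ c).1 (top δ c).2 ⊆ cell δ (c + (0, 1)) :=
  (convex_cell δ _).segment_subset (vertex_mem_cell hδ (by simp) (by simp))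
    (vertex_mem_cell hδ (by simp) (by simp))

theorem left_subset_cell_left (hδ : 0 < δ) (c : ℤ × ℤ) :
    segment ℝ (left δ c).1 (left δ c).2 ⊆ cell δ (c - (1, 0)) :=
  (convex_cell δ _).segment_subset (vertex_mem_cell hδ (by simp) (by simp))
    (vertex_mem_cell hδ (by simp) (by simp))

/-- The edges of the cells in `S` that are not shared by two cells in `S`. -/
def boundary (δ : ℝ) (S : Finset (ℤ × ℤ)) : Multiset (ℂ × ℂ) :=
  (S.filter fun c => c - (0, 1) ∉ S).val.map (bottom δ) +
  (S.filter fun c => c + (0, 1) ∉ S).val.map (top δ) +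
  ((S.filter fun c => c - (1, 0) ∉ S).val.map (left δ) +
  (S.filter fun c => c + (1, 0) ∉ S).val.map (right δ))

/-- Cancellation of shared edges: `v c` is the contribution of a side of `c`, and the neighbour `c +
e` runs through that side in the opposite direction. -/
theorem sum_filter_add_sum_filter {α M : Type*} [AddCommGroup α] [DecidableEq α] [AddCommGroup M]
    (S : Finset α) (e : α) (u v : α → M) (h : ∀ c, v c = -u (c + e)) :
    ∑ c ∈ S with c - e ∉ S, u c + ∑ c ∈ S with c + e ∉ S, v c = ∑ c ∈ S, u c + ∑ c ∈ S, v c := by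
  have h1 := Finset.sum_filter_add_sum_filter_not S (fun c => c - e ∈ S) u
  have h2 := Finset.sum_filter_add_sum_filter_not S (fun c => c + e ∈ S) v
  have h3 : ∑ c ∈ S with c + e ∈ S, v c = -∑ c ∈ S with c - e ∈ S, u c := by
    rw [← Finset.sum_neg_distrib]
    refine Finset.sum_bij' (fun c _ => c + e) (fun c _ => c - e) ?_ ?_ ?_ ?_ ?_ <;>
      simp +contextual [h]
  rw [← h1, ← h2, h3]
  abel

/-- The sum over the positively oriented boundary of a cell. -/
def cellSum {M : Type*} [AddCommGroup M] (φ : ℂ × ℂ → M) (δ : ℝ) (c : ℤ × ℤ) : M :=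
  φ (bottom δ c) + φ (top δ c) + (φ (left δ c) + φ (right δ c))

theorem sum_boundary {M : Type*} [AddCommGroup M] (φ : ℂ × ℂ → M) (hφ : ∀ s, φ s.swap = -φ s)
    (δ : ℝ) (S : Finset (ℤ × ℤ)) :
    ((boundary δ S).map φ).sum = ∑ c ∈ S, cellSum φ δ c := by
  have h1 := sum_filter_add_sum_filter S (0, 1) (fun c => φ (bottom δ c)) (fun c => φ (top δ c))
    fun c => by rw [top_eq_swap, hφ]
  have h2 := sum_filter_add_sum_filter S (1, 0) (fun c => φ (left δ c)) (fun c => φ (right δ c))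
    fun c => by rw [right_eq_swap, hφ]
  simp only [cellSum, Finset.sum_add_distrib]
  rw [← h1, ← h2]
  simp only [boundary, Multiset.map_add, Multiset.sum_add, Multiset.map_map, Finset.sum]
  rfl

theorem count_map_fst_sub_count_map_snd (m : Multiset (ℂ × ℂ)) (x : ℂ) :
    ((m.map Prod.fst).count x : ℤ) - (m.map Prod.snd).count x =
      (m.map fun s => (if x = s.1 then 1 else 0) - (if x = s.2 then 1 else 0)).sum := by
  induction m using Multiset.induction with
  | empty => simp
  | cons s m ih =>
    simp only [Multiset.map_cons, Multiset.count_cons, Multiset.sum_cons, ← ih]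
    push_cast
    ring

theorem boundary_balanced (δ : ℝ) (S : Finset (ℤ × ℤ)) :
    (boundary δ S).map Prod.fst = (boundary δ S).map Prod.snd := by
  ext x
  have h := count_map_fst_sub_count_map_snd (boundary δ S) x
  -- The excess of departures over arrivals at `x` is odd under reversal, so it can be summed cell
  -- by cell, and it vanishes around each cell.
  rw [sum_boundary (fun s : ℂ × ℂ => (if x = s.1 then (1 : ℤ) else 0) - (if x = s.2 then 1 else 0))
    (fun s => by simp), Finset.sum_eq_zero] at h
  · exact_mod_cast sub_eq_zero.1 h
  · intro c _
    simp only [cellSum, bottom, top, left, right]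
    ring_nf
    exact sub_eq_zero.2 (by congr)

/-- The boundary of a finite union of cells. -/
def contour (δ : ℝ) (S : Finset (ℤ × ℤ)) : Contour := ⟨boundary δ S, boundary_balanced δ S⟩

theorem integral_contour {E : Type*} [NormedAddCommGroup E] [NormedSpace ℂ E] (δ : ℝ)
    (S : Finset (ℤ × ℤ)) (F : ℂ → E) :
    (contour δ S).integral F = ∑ c ∈ S, cellSum (fun s => segIntegral s F) δ c := by
  rw [Contour.integral_eq]
  exact sum_boundary _ (fun s => segIntegral_swap s F) δ S

theorem exists_cell_of_mem_trace (hδ : 0 < δ) {S : Finset (ℤ × ℤ)} {z : ℂ}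
    (hz : z ∈ (contour δ S).trace) : (∃ c ∈ S, z ∈ cell δ c) ∧ ∃ c ∉ S, z ∈ cell δ c := by
  obtain ⟨s, hs, hzs⟩ := mem_iUnion₂.1 hz
  simp only [mem_ofPred_eq, contour, boundary, Multiset.mem_add, Multiset.mem_map,
    Finset.mem_val, Finset.mem_filter] at hs
  rcases hs with (⟨c, hc, rfl⟩ | ⟨c, hc, rfl⟩) | (⟨c, hc, rfl⟩ | ⟨c, hc, rfl⟩)
  · exact ⟨⟨c, hc.1, bottom_subset_cell hδ c hzs⟩, _, hc.2, bottom_subset_cell_below hδ c hzs⟩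
  · exact ⟨⟨c, hc.1, top_subset_cell hδ c hzs⟩, _, hc.2, top_subset_cell_above hδ c hzs⟩
  · exact ⟨⟨c, hc.1, left_subset_cell hδ c hzs⟩, _, hc.2, left_subset_cell_left hδ c hzs⟩
  · exact ⟨⟨c, hc.1, right_subset_cell hδ c hzs⟩, _, hc.2, right_subset_cell_right hδ c hzs⟩

theorem cellSum_eq_zero_of_hasDerivAt (hδ : 0 < δ) {c : ℤ × ℤ} {F F' : ℂ → ℂ}
    (h : ∀ z ∈ cell δ c, HasDerivAt F (F' z) z) (hc : ContinuousOn F' (cell δ c)) :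
    cellSum (fun s => segIntegral s F') δ c = 0 := by
  simp only [cellSum]
  rw [segIntegral_eq_sub (fun z hz => h z (bottom_subset_cell hδ c hz))
      (hc.mono (bottom_subset_cell hδ c)),
    segIntegral_eq_sub (fun z hz => h z (top_subset_cell hδ c hz))
      (hc.mono (top_subset_cell hδ c)),
    segIntegral_eq_sub (fun z hz => h z (left_subset_cell hδ c hz))
      (hc.mono (left_subset_cell hδ c)),
    segIntegral_eq_sub (fun z hz => h z (right_subset_cell hδ c hz))
      (hc.mono (right_subset_cell hδ c))]
  simp only [bottom, top, left, right]
  ring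

/-- The cell lies in a half-plane where `log (u (z - w))` is a primitive of `(z - w)⁻¹`; `u` rotates
that half-plane to the right one. -/
theorem cellSum_inv_sub_of_re_pos (hδ : 0 < δ) {c : ℤ × ℤ} {u w : ℂ}
    (h : ∀ z ∈ cell δ c, 0 < (u * (z - w)).re) :
    cellSum (fun s => segIntegral s fun z => (z - w)⁻¹) δ c = 0 := by
  have hne : ∀ z ∈ cell δ c, u * (z - w) ≠ 0 := fun z hz h0 => by
    have := h z hz
    simp [h0] at this
  refine cellSum_eq_zero_of_hasDerivAt (F := fun z => Complex.log (u * (z - w))) hδ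
    (fun z hz => ?_) ((continuousOn_id.sub continuousOn_const).inv₀
      fun z hz => right_ne_zero_of_mul (hne z hz))
  have h1 : HasDerivAt (fun z : ℂ => u * (z - w)) (u * 1) z :=
    ((hasDerivAt_id z).sub_const w).const_mul u
  have h2 := h1.clog (Or.inl (h z hz))
  rwa [mul_div_mul_left _ _ (left_ne_zero_of_mul (hne z hz)), one_div] at h2

theorem cellSum_inv_sub_of_notMem (hδ : 0 < δ) {c : ℤ × ℤ} {w : ℂ} (hw : w ∉ cell δ c) :
    cellSum (fun s => segIntegral s fun z => (z - w)⁻¹) δ c = 0 := by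
  simp only [cell, Complex.mem_reProdIm, mem_Icc, not_and_or, not_le] at hw
  rcases hw with (h | h) | (h | h)
  · refine cellSum_inv_sub_of_re_pos (u := 1) hδ fun z hz => ?_
    have := hz.1.1
    simp only [one_mul, Complex.sub_re]
    linarith
  · refine cellSum_inv_sub_of_re_pos (u := -1) hδ fun z hz => ?_
    have := hz.1.2
    simp only [neg_mul, one_mul, Complex.neg_re, Complex.sub_re]
    linarith
  · refine cellSum_inv_sub_of_re_pos (u := -Complex.I) hδ fun z hz => ?_
    have := hz.2.1
    simp only [neg_mul, Complex.neg_re, Complex.mul_re, Complex.I_re, Complex.I_im, Complex.sub_im]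
    linarith
  · refine cellSum_inv_sub_of_re_pos (u := Complex.I) hδ fun z hz => ?_
    have := hz.2.2
    simp only [Complex.mul_re, Complex.I_re, Complex.I_im, Complex.sub_im]
    linarith

/-- The hypothesis says that `w` lies strictly to the left of the line from `p` to `q`, so the
argument increases by less than a half turn. -/
theorem segIntegral_inv_sub_of_cross_pos {p q w : ℂ}
    (h : 0 < (q - w).im * (p - w).re - (q - w).re * (p - w).im) :
    Complex.exp (segIntegral (p, q) fun z => (z - w)⁻¹) = (q - w) / (p - w) ∧
      0 < (segIntegral (p, q) fun z => (z - w)⁻¹).im ∧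
      (segIntegral (p, q) fun z => (z - w)⁻¹).im < Real.pi := by
  have hw : w ∉ segment ℝ p q := by
    intro hmem
    rw [segment_eq_image'] at hmem
    obtain ⟨t, -, rfl⟩ := hmem
    simp only [Complex.sub_im, Complex.sub_re, Complex.add_re, Complex.add_im, Complex.smul_re,
      Complex.smul_im, smul_eq_mul] at h
    ring_nf at h
    exact lt_irrefl _ h
  have hp : p - w ≠ 0 := fun h0 => by simp [h0] at h
  have hq : q - w ≠ 0 := fun h0 => by simp [h0] at h
  rw [segIntegral_inv_sub hw]
  have him : 0 < ((q - w) / (p - w)).im := by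
    rw [Complex.div_im, ← sub_div]
    exact div_pos h (Complex.normSq_pos.2 hp)
  refine ⟨Complex.exp_log (div_ne_zero hq hp), ?_, ?_⟩
  · rw [Complex.log_im]
    exact (Complex.arg_nonneg_iff.2 him.le).lt_of_ne fun h0 =>
      him.ne' (Complex.arg_eq_zero_iff.1 h0.symm).2
  · rw [Complex.log_im]
    exact Complex.arg_lt_pi_iff.2 (Or.inr him.ne')

/-- Four increments of argument in `(0, π)` add up to a multiple of `2π` strictly between `0` and
`4π`. -/
theorem cellSum_inv_sub_of_mem_interior {c : ℤ × ℤ} {w : ℂ}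
    (hw : w ∈ Ioo (c.1 * δ) ((c.1 + 1) * δ) ×ℂ Ioo (c.2 * δ) ((c.2 + 1) * δ)) :
    cellSum (fun s => segIntegral s fun z => (z - w)⁻¹) δ c = 2 * Real.pi * Complex.I := by
  obtain ⟨⟨h1, h2⟩, h3, h4⟩ := hw
  have hδ : 0 < δ := by nlinarith
  obtain ⟨b1, b2, b3⟩ := segIntegral_inv_sub_of_cross_pos (p := vertex δ c.1 c.2)
    (q := vertex δ (c.1 + 1) c.2) (w := w) (by simp [vertex]; nlinarith)
  obtain ⟨r1, r2, r3⟩ := segIntegral_inv_sub_of_cross_pos (p := vertex δ (c.1 + 1) c.2)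
    (q := vertex δ (c.1 + 1) (c.2 + 1)) (w := w) (by simp [vertex]; nlinarith)
  obtain ⟨t1, t2, t3⟩ := segIntegral_inv_sub_of_cross_pos (p := vertex δ (c.1 + 1) (c.2 + 1))
    (q := vertex δ c.1 (c.2 + 1)) (w := w) (by simp [vertex]; nlinarith)
  obtain ⟨l1, l2, l3⟩ := segIntegral_inv_sub_of_cross_pos (p := vertex δ c.1 (c.2 + 1))
    (q := vertex δ c.1 c.2) (w := w) (by simp [vertex]; nlinarith)
  have n1 : vertex δ c.1 c.2 - w ≠ 0 := fun h => by
    have := congrArg Complex.re h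
    simp [vertex] at this
    linarith
  have n2 : vertex δ (c.1 + 1) c.2 - w ≠ 0 := fun h => by
    have := congrArg Complex.re h
    simp [vertex] at this
    linarith
  have n3 : vertex δ (c.1 + 1) (c.2 + 1) - w ≠ 0 := fun h => by
    have := congrArg Complex.re h
    simp [vertex] at this
    linarith
  have n4 : vertex δ c.1 (c.2 + 1) - w ≠ 0 := fun h => by
    have := congrArg Complex.re h
    simp [vertex] at this
    linarith
  set B := segIntegral (vertex δ c.1 c.2, vertex δ (c.1 + 1) c.2) fun z => (z - w)⁻¹
  set R := segIntegral (vertex δ (c.1 + 1) c.2, vertex δ (c.1 + 1) (c.2 + 1)) fun z => (z - w)⁻¹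
  set T := segIntegral (vertex δ (c.1 + 1) (c.2 + 1), vertex δ c.1 (c.2 + 1)) fun z => (z - w)⁻¹
  set L := segIntegral (vertex δ c.1 (c.2 + 1), vertex δ c.1 c.2) fun z => (z - w)⁻¹
  change B + T + (L + R) = _
  have hexp : Complex.exp (B + T + (L + R)) = 1 := by
    rw [Complex.exp_add, Complex.exp_add, Complex.exp_add, b1, r1, t1, l1]
    field_simp
  obtain ⟨n, hn⟩ := Complex.exp_eq_one_iff.1 hexp
  have him := congrArg Complex.im hn
  simp only [Complex.add_im, Complex.mul_im, Complex.mul_re, Complex.I_re, Complex.I_im,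
    Complex.ofReal_re, Complex.ofReal_im, Complex.intCast_re, Complex.intCast_im, Complex.re_ofNat,
    Complex.im_ofNat] at him
  have hpi := Real.pi_pos
  have hn0 : (0 : ℝ) < n := by nlinarith
  have hn2 : (n : ℝ) < 2 := by nlinarith
  have : n = 1 := by
    have h0 : 0 < n := by exact_mod_cast hn0
    have h2 : n < 2 := by exact_mod_cast hn2
    omega
  rw [hn, this]
  simp

theorem exists_mem_cell (hδ : 0 < δ) (z : ℂ) : ∃ c, z ∈ cell δ c := by
  refine ⟨(⌊z.re / δ⌋, ⌊z.im / δ⌋), ⟨?_, ?_⟩, ?_, ?_⟩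
  · exact (le_div_iff₀ hδ).1 (Int.floor_le _)
  · exact (div_le_iff₀ hδ).1 (Int.lt_floor_add_one _).le
  · exact (le_div_iff₀ hδ).1 (Int.floor_le _)
  · exact (div_le_iff₀ hδ).1 (Int.lt_floor_add_one _).le

theorem finite_cells (hδ : 0 < δ) {K : Set ℂ} (hK : IsCompact K) :
    {c | (cell δ c ∩ K).Nonempty}.Finite := by
  obtain ⟨R, hR⟩ := hK.isBounded.exists_norm_le
  obtain ⟨N, hN⟩ := exists_nat_gt (R / δ)
  rw [div_lt_iff₀ hδ] at hN
  refine ((finite_Icc (-(N : ℤ) - 1) N).prod (finite_Icc (-(N : ℤ) - 1) N)).subset ?_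
  rintro c ⟨z, ⟨⟨h1, h2⟩, h3, h4⟩, hzK⟩
  have hre := abs_le.1 ((Complex.abs_re_le_norm z).trans (hR z hzK))
  have him := abs_le.1 ((Complex.abs_im_le_norm z).trans (hR z hzK))
  have aux : ∀ (i : ℤ) (x : ℝ), i * δ ≤ x → x ≤ (i + 1) * δ → -R ≤ x → x ≤ R →
      i ∈ Icc (-(N : ℤ) - 1) N := by
    intro i x ha hb hc hd
    have e1 : (i : ℝ) < N := by
      by_contra! hh
      nlinarith
    have e2 : -(N : ℝ) < i + 1 := by
      by_contra! hh
      nlinarith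
    have e1' : i < N := by exact_mod_cast e1
    have e2' : -(N : ℤ) < i + 1 := by exact_mod_cast e2
    constructor <;> omega
  exact ⟨aux _ _ h1 h2 hre.1 hre.2, aux _ _ h3 h4 him.1 him.2⟩

theorem dist_le_of_mem_cell {c : ℤ × ℤ} {z w : ℂ} (hz : z ∈ cell δ c) (hw : w ∈ cell δ c) :
    dist z w ≤ 2 * δ := by
  obtain ⟨⟨h1, h2⟩, h3, h4⟩ := hz
  obtain ⟨⟨h5, h6⟩, h7, h8⟩ := hw
  rw [dist_eq_norm]
  refine (Complex.norm_le_abs_re_add_abs_im _).trans ?_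
  have e1 : |(z - w).re| ≤ δ := by
    rw [Complex.sub_re, abs_le]
    constructor <;> linarith
  have e2 : |(z - w).im| ≤ δ := by
    rw [Complex.sub_im, abs_le]
    constructor <;> linarith
  linarith

end Grid

/-- Every compact subset of an open set is surrounded by a contour that integrates all functions
holomorphic on the open set to zero. -/
theorem exists_surrounds {K U : Set ℂ} (hK : IsCompact K) (hU : IsOpen U) (hKU : K ⊆ U) :
    ∃ Γ : Contour, Γ.Surrounds K U ∧
      ∀ h : ℂ → ℂ, DifferentiableOn ℂ h U → Γ.integral h = 0 := by
  obtain ⟨ε, hε, hεU⟩ := hK.exists_thickening_subset_open hU hKU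
  -- Cells have diameter at most `2 * δ`, so a cell meeting `K` lies in an `ε`-ball about a point of
  -- `K`, inside `U`.
  obtain ⟨δ, hδ, hδε⟩ : ∃ δ : ℝ, 0 < δ ∧ 2 * δ < ε := ⟨ε / 4, by positivity, by linarith⟩
  set S := (Grid.finite_cells hδ hK).toFinset
  have hball : ∀ c ∈ S, ∃ z ∈ K, Grid.cell δ c ⊆ Metric.ball z ε ∧ Metric.ball z ε ⊆ U := by
    intro c hc
    obtain ⟨z, hzc, hzK⟩ := (Grid.finite_cells hδ hK).mem_toFinset.1 hc
    refine ⟨z, hzK, fun w hw => (Grid.dist_le_of_mem_cell hw hzc).trans_lt hδε, ?_⟩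
    exact (Metric.ball_subset_thickening hzK ε).trans hεU
  have htrace : (Grid.contour δ S).trace ⊆ U \ K := by
    intro z hz
    obtain ⟨⟨c, hc, hzc⟩, c', hc', hzc'⟩ := Grid.exists_cell_of_mem_trace hδ hz
    obtain ⟨x, -, hx, hx'⟩ := hball c hc
    exact ⟨hx' (hx hzc), fun hzK =>
      hc' ((Grid.finite_cells hδ hK).mem_toFinset.2 ⟨z, hzc', hzK⟩)⟩
  have hzero : ∀ h : ℂ → ℂ, DifferentiableOn ℂ h U → (Grid.contour δ S).integral h = 0 := by
    intro h hh
    rw [Grid.integral_contour]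
    refine Finset.sum_eq_zero fun c hc => ?_
    obtain ⟨x, -, hx, hx'⟩ := hball c hc
    -- Each cell sits in a disc inside `U`, where a holomorphic function has a primitive.
    obtain ⟨F, hF⟩ := (hh.mono hx').isExactOn_ball
    exact Grid.cellSum_eq_zero_of_hasDerivAt hδ (fun z hz => hF z (hx hz))
      (hh.continuousOn.mono (hx.trans hx'))
  refine ⟨Grid.contour δ S, ⟨fun s hs => ((Grid.contour δ S).segment_subset_trace hs).trans htrace,
    fun ζ hζ => ?_, fun ζ hζ => ?_⟩, hzero⟩
  · obtain ⟨c, hc⟩ := Grid.exists_mem_cell hδ ζ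
    have hcS : c ∈ S := (Grid.finite_cells hδ hK).mem_toFinset.2 ⟨ζ, hc, hζ⟩
    -- Since `ζ` may lie on a grid edge, the index is computed at a nearby interior point `w` of its
    -- cell.
    have hev := Contour.eventually_index_eq (Γ := Grid.contour δ S) fun h => (htrace h).2 hζ
    have hcl : ζ ∈ closure (Ioo (c.1 * δ) ((c.1 + 1) * δ) ×ℂ Ioo (c.2 * δ) ((c.2 + 1) * δ)) := by
      rw [Complex.closure_reProdIm, closure_Ioo, closure_Ioo]
      · exact hc
      · nlinarith
      · nlinarith
    obtain ⟨w, hw, hwc⟩ := mem_closure_iff_nhds.1 hcl _ hev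
    have hw : (Grid.contour δ S).index w = (Grid.contour δ S).index ζ := hw
    rw [← hw, Contour.index, Grid.integral_contour, Finset.sum_eq_single c,
      Grid.cellSum_inv_sub_of_mem_interior hwc, inv_mul_cancel₀ Complex.two_pi_I_ne_zero]
    · intro c' _ hne
      refine Grid.cellSum_inv_sub_of_notMem hδ fun hwc' => hne ?_
      obtain ⟨⟨a1, a2⟩, a3, a4⟩ := hwc
      obtain ⟨⟨b1, b2⟩, b3, b4⟩ := hwc'
      have aux : ∀ (i j : ℤ) (x : ℝ), i * δ < x → x < (i + 1) * δ → j * δ ≤ x →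
          x ≤ (j + 1) * δ → j = i := by
        intro i j x h1 h2 h3 h4
        have e1 : (j : ℝ) < i + 1 := lt_of_mul_lt_mul_right (h3.trans_lt h2) hδ.le
        have e2 : (i : ℝ) < j + 1 := lt_of_mul_lt_mul_right (h1.trans_le h4) hδ.le
        have e1' : j < i + 1 := by exact_mod_cast e1
        have e2' : i < j + 1 := by exact_mod_cast e2
        omega
      exact Prod.ext (aux _ _ _ a1 a2 b1 b2) (aux _ _ _ a3 a4 b3 b4)
    · exact fun h => absurd hcS h
  · rw [Contour.index, hzero, mul_zero]
    intro z hz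
    have : z - ζ ≠ 0 := fun h => hζ (by rwa [← sub_eq_zero.1 h])
    exact ((differentiableAt_id.sub_const ζ).inv this).differentiableWithinAt

/-! ### Cauchy's formula and divided differences -/

section Cauchy

variable {K U : Set ℂ} {Γ : Contour}

theorem continuousOn_inv_sub {T : Set ℂ} {w : ℂ} (hw : w ∉ T) :
    ContinuousOn (fun z => (z - w)⁻¹) T :=
  ContinuousOn.inv₀ (by fun_prop) fun z hz h => hw (by rwa [← sub_eq_zero.1 h])

theorem dslope_eq_mul_inv_sub_mul_inv (f : ℂ → ℂ) {z w : ℂ} (h : z ≠ w) :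
    dslope f w z = f z * (z - w)⁻¹ - f w * (z - w)⁻¹ := by
  rw [dslope_of_ne f h, slope_def_field, div_eq_mul_inv, sub_mul]

theorem two_pi_I_mul_index (Γ : Contour) (w : ℂ) :
    Γ.integral (fun z => (z - w)⁻¹) = (2 * (Real.pi : ℂ) * Complex.I) * Γ.index w := by
  rw [Contour.index, mul_inv_cancel_left₀ Complex.two_pi_I_ne_zero]

/-- The Cauchy integral formula. -/
theorem cauchy_formula (hU : IsOpen U) (hΓ : Γ.Surrounds K U)
    (hzero : ∀ h : ℂ → ℂ, DifferentiableOn ℂ h U → Γ.integral h = 0) {h : ℂ → ℂ}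
    (hh : DifferentiableOn ℂ h U) {w : ℂ} (hw : w ∈ K) (hwU : w ∈ U) :
    Γ.integral (fun z => h z * (z - w)⁻¹) = (2 * (Real.pi : ℂ) * Complex.I) * h w := by
  have hwt : w ∉ Γ.trace := fun h => (hΓ.trace_subset h).2 hw
  -- The difference quotient of `h` at `w` is holomorphic on `U`, so it integrates to zero;
  -- splitting it on the trace gives the formula.
  have h1 := hzero _ ((Complex.differentiableOn_dslope (hU.mem_nhds hwU)).2 hh)
  have hc : ContinuousOn h Γ.trace :=
    hh.continuousOn.mono fun z hz => (hΓ.trace_subset hz).1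
  have hi := continuousOn_inv_sub hwt
  rw [Contour.integral_congr fun z hz => dslope_eq_mul_inv_sub_mul_inv h
    fun hzw : z = w => hwt (hzw ▸ hz), Contour.integral_sub (hc.fun_mul hi) (continuousOn_const.fun_mul hi),
    sub_eq_zero] at h1
  rw [h1]
  have h2 := Contour.integral_const_smul (h w) hi
  simp only [smul_eq_mul] at h2
  rw [h2, two_pi_I_mul_index, hΓ.index_eq_one w hw]
  ring

/-- For `v = w` the integrand is exact; otherwise partial fractions leave a difference of two
indices, both `1`. -/
theorem integral_inv_mul_inv_eq_zero (hΓ : Γ.Surrounds K U) {v w : ℂ} (hv : v ∈ K) (hw : w ∈ K) :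
    Γ.integral (fun z => (z - v)⁻¹ * (z - w)⁻¹) = 0 := by
  have hvt : v ∉ Γ.trace := fun h => (hΓ.trace_subset h).2 hv
  have hwt : w ∉ Γ.trace := fun h => (hΓ.trace_subset h).2 hw
  have hvc := continuousOn_inv_sub hvt
  have hwc := continuousOn_inv_sub hwt
  have hvz := Contour.sub_ne_zero_of_notMem_trace hvt
  have hwz := Contour.sub_ne_zero_of_notMem_trace hwt
  rcases eq_or_ne v w with rfl | hne
  · refine Contour.integral_eq_zero_of_hasDerivAt (F := fun z => -(z - v)⁻¹) (fun z hz => ?_)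
      (hvc.fun_mul hvc)
    have h1 := (((hasDerivAt_id z).sub_const v).fun_inv (hvz z hz)).fun_neg
    have h2 : -(-1 / (id z - v) ^ 2) = (z - v)⁻¹ * (z - v)⁻¹ := by
      have := hvz z hz
      simp only [id]
      field_simp
    rw [h2] at h1
    exact h1
  · have hd : v - w ≠ 0 := sub_ne_zero.2 hne
    have h1 : ∀ z ∈ Γ.trace, (z - v)⁻¹ * (z - w)⁻¹ = (v - w)⁻¹ • ((z - v)⁻¹ - (z - w)⁻¹) := by
      intro z hz
      have := hvz z hz
      have := hwz z hz
      rw [smul_eq_mul]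
      field_simp
      ring
    rw [Contour.integral_congr h1, Contour.integral_const_smul _ (hvc.fun_sub hwc),
      Contour.integral_sub hvc hwc, two_pi_I_mul_index, two_pi_I_mul_index,
      hΓ.index_eq_one v hv, hΓ.index_eq_one w hw, sub_self, smul_zero]

/-- The integral formula for divided differences. -/
theorem cauchy_formula_dslope (hU : IsOpen U) (hΓ : Γ.Surrounds K U) (hKU : K ⊆ U)
    (hzero : ∀ h : ℂ → ℂ, DifferentiableOn ℂ h U → Γ.integral h = 0) {f : ℂ → ℂ}
    (hf : DifferentiableOn ℂ f U) {v w : ℂ} (hv : v ∈ K) (hw : w ∈ K) :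
    Γ.integral (fun z => f z * ((z - v)⁻¹ * (z - w)⁻¹)) =
      (2 * (Real.pi : ℂ) * Complex.I) * dslope f w v := by
  have hvt : v ∉ Γ.trace := fun h => (hΓ.trace_subset h).2 hv
  have hwt : w ∉ Γ.trace := fun h => (hΓ.trace_subset h).2 hw
  have hc : ContinuousOn f Γ.trace :=
    hf.continuousOn.mono fun z hz => (hΓ.trace_subset hz).1
  have hm := (continuousOn_inv_sub hvt).fun_mul (continuousOn_inv_sub hwt)
  rw [← cauchy_formula hU hΓ hzero
    ((Complex.differentiableOn_dslope (hU.mem_nhds (hKU hw))).2 hf) hv (hKU hv),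
    Contour.integral_congr (F := fun z => dslope f w z * (z - v)⁻¹)
      (G := fun z => f z * ((z - v)⁻¹ * (z - w)⁻¹) - f w • ((z - v)⁻¹ * (z - w)⁻¹)),
    Contour.integral_sub (hc.fun_mul hm) (hm.fun_const_smul _), Contour.integral_const_smul _ hm,
    integral_inv_mul_inv_eq_zero hΓ hv hw, smul_zero, sub_zero]
  intro z hz
  rw [dslope_eq_mul_inv_sub_mul_inv f fun hzw : z = w => hwt (hzw ▸ hz), smul_eq_mul]
  ring

/-- In the integral formula the integrand is jointly continuous on a compact set, which gives a
bound uniform up to the diagonal. -/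
theorem exists_norm_dslope_le (hK : IsCompact K) (hU : IsOpen U) (hKU : K ⊆ U) {f : ℂ → ℂ}
    (hf : DifferentiableOn ℂ f U) : ∃ M, ∀ v ∈ K, ∀ w ∈ K, ‖dslope f w v‖ ≤ M := by
  obtain ⟨Γ, hΓ, hzero⟩ := exists_surrounds hK hU hKU
  obtain ⟨C, hC⟩ := Γ.exists_norm_integral_le
  have hcont : ContinuousOn (fun p : ℂ × ℂ × ℂ => f p.1 * ((p.1 - p.2.1)⁻¹ * (p.1 - p.2.2)⁻¹))
      (Γ.trace ×ˢ K ×ˢ K) := by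
    have hc : ContinuousOn (fun p : ℂ × ℂ × ℂ => f p.1) (Γ.trace ×ˢ K ×ˢ K) :=
      (hf.continuousOn.mono fun z hz => (hΓ.trace_subset hz).1).comp continuousOn_fst
        fun p hp => hp.1
    refine hc.mul (ContinuousOn.mul ?_ ?_)
    · refine ContinuousOn.inv₀ (by fun_prop) fun p hp h => ?_
      exact (hΓ.trace_subset hp.1).2 (by rw [sub_eq_zero.1 h]; exact hp.2.1)
    · refine ContinuousOn.inv₀ (by fun_prop) fun p hp h => ?_
      exact (hΓ.trace_subset hp.1).2 (by rw [sub_eq_zero.1 h]; exact hp.2.2)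
  obtain ⟨M, hM⟩ := (Γ.isCompact_trace.prod (hK.prod hK)).exists_bound_of_continuousOn hcont
  refine ⟨‖(2 * (Real.pi : ℂ) * Complex.I)‖⁻¹ * (C * M), fun v hv w hw => ?_⟩
  have h1 := hC (fun z => f z * ((z - v)⁻¹ * (z - w)⁻¹)) M fun z hz => hM (z, v, w) ⟨hz, hv, hw⟩
  rw [cauchy_formula_dslope hU hΓ hKU hzero hf hv hw, norm_mul] at h1
  rwa [le_inv_mul_iff₀ (norm_pos_iff.2 Complex.two_pi_I_ne_zero)]

end Cauchy

/-! ### Resolvent identities and comparison of contours -/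

section Resolvent

variable {A : Type*} [NormedRing A] [NormedAlgebra ℂ A]

theorem resolvent_mul_sub {a : A} {z : ℂ} (hz : z ∉ spectrum ℂ a) :
    resolvent a z * (algebraMap ℂ A z - a) = 1 :=
  Ring.inverse_mul_cancel _ (spectrum.notMem_iff.1 hz)

theorem sub_mul_resolvent {a : A} {z : ℂ} (hz : z ∉ spectrum ℂ a) :
    (algebraMap ℂ A z - a) * resolvent a z = 1 :=
  Ring.mul_inverse_cancel _ (spectrum.notMem_iff.1 hz)

theorem resolvent_eq_of_mul_eq_one {a x : A} {z : ℂ} (h1 : (algebraMap ℂ A z - a) * x = 1)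
    (h2 : x * (algebraMap ℂ A z - a) = 1) : resolvent a z = x := by
  have hz : z ∉ spectrum ℂ a := spectrum.notMem_iff.2 ⟨⟨_, x, h1, h2⟩, rfl⟩
  calc resolvent a z = resolvent a z * ((algebraMap ℂ A z - a) * x) := by rw [h1, mul_one]
    _ = x := by rw [← mul_assoc, resolvent_mul_sub hz, one_mul]

/-- Contains both resolvent identities: the case `a = b` compares contours, the case `w = z`
produces the factor `a - b`. -/
theorem resolvent_sub_resolvent {a b : A} {w z : ℂ} (hw : w ∉ spectrum ℂ a)
    (hz : z ∉ spectrum ℂ b) :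
    resolvent a w - resolvent b z =
      resolvent a w * ((algebraMap ℂ A z - b) - (algebraMap ℂ A w - a)) * resolvent b z := by
  rw [mul_sub, sub_mul, mul_assoc, sub_mul_resolvent hz, resolvent_mul_sub hw, mul_one, one_mul]

variable [CompleteSpace A]

theorem continuousOn_resolvent {a : A} {T : Set ℂ} (hT : ∀ z ∈ T, z ∉ spectrum ℂ a) :
    ContinuousOn (resolvent a) T := fun z hz =>
  (spectrum.hasDerivAt_resolvent_const_left
    (spectrum.mem_resolventSet_iff.2 (spectrum.notMem_iff.1 (hT z hz)))).continuousAt.continuousWithinAt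

/-- If a contour `Γ₀` around the hull of `Γ` reproduces `f` on `Γ`, then the Riesz integrals of `f`
over `Γ` and `Γ₀` differ by the Riesz idempotent of `Γ`. -/
theorem rieszIntegral_eq_mul {a : A} {Γ Γ₀ : Contour} {f : ℂ → ℂ} {U : Set ℂ}
    (hΓ : Γ.Surrounds (spectrum ℂ a) U) (hdisj : Disjoint Γ₀.trace Γ.hull)
    (hf : ContinuousOn f Γ.trace) (hf₀ : ContinuousOn f Γ₀.trace)
    (hcauchy : ∀ w ∈ Γ.trace,
      Γ₀.integral (fun z => f z * (z - w)⁻¹) = (2 * (Real.pi : ℂ) * Complex.I) * f w) :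
    rieszIntegral Γ f a = rieszIntegral Γ 1 a * rieszIntegral Γ₀ f a := by
  have hπ := Complex.two_pi_I_ne_zero
  have hσ : ∀ w ∈ Γ.trace, w ∉ spectrum ℂ a := fun w hw => (hΓ.trace_subset hw).2
  have hσ₀ : ∀ z ∈ Γ₀.trace, z ∉ spectrum ℂ a := fun z hz h =>
    disjoint_left.1 hdisj hz (hΓ.subset_hull h)
  have htr : ∀ z ∈ Γ₀.trace, z ∉ Γ.trace := fun z hz h => disjoint_left.1 hdisj hz (Or.inl h)
  have hR := continuousOn_resolvent hσ
  have hR₀ := continuousOn_resolvent hσ₀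
  have h1 : (2 * (Real.pi : ℂ) * Complex.I) • Γ.integral (fun w => f w • resolvent a w) =
      Γ.integral fun w => Γ₀.integral fun z => (f z * (z - w)⁻¹) • resolvent a w := by
    rw [← Contour.integral_const_smul _ (hf.fun_smul hR)]
    refine Contour.integral_congr fun w hw => ?_
    rw [Contour.integral_smul_const (hf₀.fun_mul (continuousOn_inv_sub
      fun h => disjoint_left.1 hdisj h (Or.inl hw))), hcauchy w hw, smul_smul]
  have hcont : ContinuousOn (Function.uncurry fun w z => (f z * (z - w)⁻¹) • resolvent a w)
      (Γ.trace ×ˢ Γ₀.trace) := by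
    refine ContinuousOn.smul (ContinuousOn.mul ?_ ?_) ?_
    · exact hf₀.comp continuousOn_snd fun p hp => hp.2
    · refine ContinuousOn.inv₀ (by fun_prop) fun p hp h => ?_
      exact htr _ hp.2 (by rw [sub_eq_zero.1 h]; exact hp.1)
    · exact hR.comp continuousOn_fst fun p hp => hp.1
  have h2 : ∀ z ∈ Γ₀.trace, Γ.integral (fun w => (f z * (z - w)⁻¹) • resolvent a w) =
      Γ.integral (resolvent a) * (f z • resolvent a z) := by
    intro z hz
    have hi := continuousOn_inv_sub (htr z hz)
    have hind : Γ.index z = 0 := by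
      by_contra h
      exact disjoint_left.1 hdisj hz (Or.inr h)
    -- The resolvent identity isolates a multiple of `(w - z)⁻¹`, whose integral vanishes because
    -- `Γ` has index `0` about `z`.
    have hpt : ∀ w ∈ Γ.trace, (f z * (z - w)⁻¹) • resolvent a w =
        resolvent a w * (f z • resolvent a z) + (w - z)⁻¹ • (-(f z • resolvent a z)) := by
      intro w hw
      have hne : z - w ≠ 0 := fun h => htr z hz (by rwa [sub_eq_zero.1 h])
      have h3 := resolvent_sub_resolvent (hσ w hw) (hσ₀ z hz)
      rw [show (algebraMap ℂ A z - a) - (algebraMap ℂ A w - a) = algebraMap ℂ A (z - w) by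
        rw [map_sub]; abel, mul_assoc, ← Algebra.smul_def, mul_smul_comm, sub_eq_iff_eq_add] at h3
      have h4 : (f z * (z - w)⁻¹) • resolvent a w =
          f z • (resolvent a w * resolvent a z) + (f z * (z - w)⁻¹) • resolvent a z := by
        conv_lhs => rw [h3, smul_add, smul_smul, mul_assoc, inv_mul_cancel₀ hne, mul_one]
      rw [h4, mul_smul_comm, ← neg_sub z w, inv_neg, neg_smul, smul_neg, neg_neg, smul_smul,
        mul_comm (f z)]
    rw [Contour.integral_congr hpt, Contour.integral_add (hR.fun_mul continuousOn_const)
      (hi.fun_smul continuousOn_const), Contour.integral_smul_const hi, two_pi_I_mul_index, hind,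
      mul_zero, zero_smul, add_zero]
    exact Contour.integral_clm ((ContinuousLinearMap.mul ℂ A).flip (f z • resolvent a z)) hR
  rw [Contour.integral_integral_swap hcont, Contour.integral_congr h2] at h1
  have h3 := Contour.integral_clm (ContinuousLinearMap.mul ℂ A (Γ.integral (resolvent a)))
    (hf₀.fun_smul hR₀)
  simp only [ContinuousLinearMap.mul_apply'] at h3
  rw [h3] at h1
  simp only [rieszIntegral, Pi.one_apply, one_smul]
  rw [smul_mul_smul_comm, ← h1, smul_smul, inv_mul_cancel_right₀ hπ]

end Resolvent

/-! ### Commutative Banach algebras and characters -/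

section Commutative

variable {D : Type*} [NormedCommRing D] [NormedAlgebra ℂ D]

open WeakDual

theorem character_mem_spectrum (χ : characterSpace ℂ D) (l : D) : χ l ∈ spectrum ℂ l :=
  AlgHom.apply_mem_spectrum χ l

theorem character_resolvent (χ : characterSpace ℂ D) {l : D} {z : ℂ} (hz : z ∉ spectrum ℂ l) :
    χ (resolvent l z) = (z - χ l)⁻¹ := by
  have h := congrArg χ (resolvent_mul_sub hz)
  rw [map_mul, map_sub, map_one, AlgHomClass.commutes] at h
  exact eq_inv_of_mul_eq_one_left h

variable [CompleteSpace D]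

theorem character_integral (χ : characterSpace ℂ D) {Γ : Contour} {F : ℂ → D}
    (hF : ContinuousOn F Γ.trace) : χ (Γ.integral F) = Γ.integral fun z => χ (F z) :=
  (Contour.integral_clm (CharacterSpace.toCLM χ) hF).symm

/-- A character `χ` maps the element to the index of `Γ` about `χ l ∈ σ(l)`, which is `1`, so no
character kills it. -/
theorem isUnit_rieszIntegral_one {l : D} {Γ : Contour} {U : Set ℂ}
    (hΓ : Γ.Surrounds (spectrum ℂ l) U) : IsUnit (rieszIntegral Γ 1 l) := by
  by_contra hn
  obtain ⟨χ, hχ⟩ := CharacterSpace.exists_apply_eq_zero hn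
  have hσ : ∀ w ∈ Γ.trace, w ∉ spectrum ℂ l := fun w hw => (hΓ.trace_subset hw).2
  simp only [rieszIntegral, Pi.one_apply, one_smul] at hχ
  rw [map_smul, character_integral χ (continuousOn_resolvent hσ),
    Contour.integral_congr fun z hz => character_resolvent χ (hσ z hz)] at hχ
  have h1 := hΓ.index_eq_one _ (character_mem_spectrum χ l)
  rw [Contour.index, ← smul_eq_mul, hχ] at h1
  exact zero_ne_one h1

/-- Take a tighter contour `Γ₁` around the spectrum within the points of index `1` for `Γ`. There
`Γ` reproduces constants, so the element `p₁` of `Γ₁` and the element `p` of `Γ` satisfy `p₁ = p₁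
p`, and the unit `p₁` cancels. -/
theorem rieszIntegral_one {l : D} {Γ : Contour} {U : Set ℂ}
    (hΓ : Γ.Surrounds (spectrum ℂ l) U) : rieszIntegral Γ 1 l = 1 := by
  set V : Set ℂ := {w | w ∉ Γ.trace ∧ Γ.index w = 1}
  have hVo : IsOpen V := by
    rw [isOpen_iff_mem_nhds]
    rintro w ⟨hw, hw1⟩
    filter_upwards [Γ.isCompact_trace.isClosed.isOpen_compl.mem_nhds hw,
      Contour.eventually_index_eq hw] with z hz hz1
    exact ⟨hz, hz1.trans hw1⟩
  obtain ⟨Γ₁, hΓ₁, -⟩ := exists_surrounds (spectrum.isCompact l) hVo fun w hw =>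
    ⟨fun h => (hΓ.trace_subset h).2 hw, hΓ.index_eq_one w hw⟩
  have h := rieszIntegral_eq_mul (f := 1) hΓ₁ (Γ₀ := Γ)
    (disjoint_left.2 fun z hz hz' => (hΓ₁.hull_subset hz').1 hz) continuousOn_const
    continuousOn_const fun w hw => by
      have := (hΓ₁.trace_subset hw).1.2
      simp only [Pi.one_apply, one_mul, mul_one]
      rw [two_pi_I_mul_index, this, mul_one]
  exact ((isUnit_rieszIntegral_one hΓ₁).mul_left_cancel ((mul_one _).trans h)).symm

theorem rieszIntegral_eq_of_surrounds_hull {l : D} {Γ Γ₀ : Contour} {K U : Set ℂ} {f : ℂ → ℂ}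
    (hU : IsOpen U) (hf : DifferentiableOn ℂ f U) (hΓ : Γ.Surrounds (spectrum ℂ l) U)
    (hΓ₀ : Γ₀.Surrounds K U) (hK : Γ.hull ⊆ K)
    (hzero : ∀ h : ℂ → ℂ, DifferentiableOn ℂ h U → Γ₀.integral h = 0) :
    rieszIntegral Γ f l = rieszIntegral Γ₀ f l := by
  rw [rieszIntegral_eq_mul hΓ (Γ₀ := Γ₀)
    (disjoint_left.2 fun z hz hz' => (hΓ₀.trace_subset hz).2 (hK hz'))
    (hf.continuousOn.mono fun z hz => (hΓ.trace_subset hz).1)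
    (hf.continuousOn.mono fun z hz => (hΓ₀.trace_subset hz).1)
    fun w hw => cauchy_formula hU hΓ₀ hzero hf (hK (Or.inl hw)) (hΓ.trace_subset hw).1,
    rieszIntegral_one hΓ, one_mul]

/-- In a commutative Banach algebra `f(l) - f(r)` is the multiple of `l - r` by an element whose
Gelfand transform is the divided difference of `f`. -/
theorem exists_rieszIntegral_sub_eq_mul {l r : D} {Γ Γ' : Contour} {U : Set ℂ} {f : ℂ → ℂ}
    (hU : IsOpen U) (hf : DifferentiableOn ℂ f U) (hΓ : Γ.Surrounds (spectrum ℂ l) U)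
    (hΓ' : Γ'.Surrounds (spectrum ℂ r) U) :
    ∃ g : D, rieszIntegral Γ f l - rieszIntegral Γ' f r = g * (l - r) ∧
      ∀ χ : characterSpace ℂ D, χ g = dslope f (χ r) (χ l) := by
  have hKU : Γ.hull ∪ Γ'.hull ⊆ U := union_subset hΓ.hull_subset hΓ'.hull_subset
  -- One contour around both hulls represents both elements, so their integrands can be subtracted.
  obtain ⟨Γ₀, hΓ₀, hzero⟩ := exists_surrounds (Γ.isCompact_hull.union Γ'.isCompact_hull) hU hKU
  have hl : ∀ z ∈ Γ₀.trace, z ∉ spectrum ℂ l := fun z hz h =>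
    (hΓ₀.trace_subset hz).2 (Or.inl (hΓ.subset_hull h))
  have hr : ∀ z ∈ Γ₀.trace, z ∉ spectrum ℂ r := fun z hz h =>
    (hΓ₀.trace_subset hz).2 (Or.inr (hΓ'.subset_hull h))
  have hfc : ContinuousOn f Γ₀.trace := hf.continuousOn.mono fun z hz => (hΓ₀.trace_subset hz).1
  have hRl := continuousOn_resolvent hl
  have hRr := continuousOn_resolvent hr
  have hFc := hfc.fun_smul (hRl.fun_mul hRr)
  refine ⟨(2 * (Real.pi : ℂ) * Complex.I)⁻¹ •
    Γ₀.integral fun z => f z • (resolvent l z * resolvent r z), ?_, fun χ => ?_⟩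
  · rw [rieszIntegral_eq_of_surrounds_hull hU hf hΓ hΓ₀ subset_union_left hzero,
      rieszIntegral_eq_of_surrounds_hull hU hf hΓ' hΓ₀ subset_union_right hzero, rieszIntegral,
      rieszIntegral, ← smul_sub, ← Contour.integral_sub (hfc.fun_smul hRl) (hfc.fun_smul hRr),
      smul_mul_assoc]
    congr 1
    refine (Contour.integral_congr fun z hz => ?_).trans
      (Contour.integral_clm ((ContinuousLinearMap.mul ℂ D).flip (l - r)) hFc)
    rw [← smul_sub, resolvent_sub_resolvent (hl z hz) (hr z hz)]
    simp only [ContinuousLinearMap.flip_apply, ContinuousLinearMap.mul_apply', smul_mul_assoc]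
    congr 1
    ring
  · rw [map_smul, character_integral χ hFc, Contour.integral_congr
      (G := fun z => f z * ((z - χ l)⁻¹ * (z - χ r)⁻¹)), cauchy_formula_dslope hU hΓ₀ hKU hzero hf
      (Or.inl (hΓ.subset_hull (character_mem_spectrum χ l)))
      (Or.inr (hΓ'.subset_hull (character_mem_spectrum χ r))), smul_eq_mul,
      inv_mul_cancel_left₀ Complex.two_pi_I_ne_zero]
    intro z hz
    rw [map_smul, map_mul, character_resolvent χ (hl z hz), character_resolvent χ (hr z hz),
      smul_eq_mul]

end Commutative

/-! ### Growth of the iterated commutators -/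

section Rho

variable {A : Type*} [NormedRing A] [NormedAlgebra ℂ A]

theorem isBoundedUnder_rho (a b : A) : IsBoundedUnder (· ≤ ·) atTop
    fun n : ℕ => ‖(commutator a b ^ n) 1‖ ^ (1 / (n : ℝ)) := by
  -- The norm of `1` need not be `1`; the factor `max 1 ‖1‖` absorbs it for `n ≥ 1`.
  refine isBoundedUnder_of_eventually_le (a := ‖commutator a b‖ * max 1 ‖(1 : A)‖) ?_
  filter_upwards [eventually_ge_atTop 1] with n hn
  have hn0 : n ≠ 0 := by omega
  have h1 : ‖(commutator a b ^ n) 1‖ ≤ (‖commutator a b‖ * max 1 ‖(1 : A)‖) ^ n := by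
    refine ((commutator a b ^ n).le_opNorm 1).trans ?_
    rw [mul_pow]
    refine mul_le_mul (norm_pow_le' _ hn) ?_ (norm_nonneg _) (by positivity)
    exact (le_max_right _ _).trans (le_self_pow₀ (le_max_left _ _) hn0)
  calc ‖(commutator a b ^ n) 1‖ ^ (1 / (n : ℝ))
      ≤ ((‖commutator a b‖ * max 1 ‖(1 : A)‖) ^ n) ^ (1 / (n : ℝ)) :=
        Real.rpow_le_rpow (norm_nonneg _) h1 (by positivity)
    _ = _ := by rw [one_div, Real.pow_rpow_inv_natCast (by positivity) hn0]

theorem isCoboundedUnder_rho (a b : A) : IsCoboundedUnder (· ≤ ·) atTop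
    fun n : ℕ => ‖(commutator a b ^ n) 1‖ ^ (1 / (n : ℝ)) :=
  isCoboundedUnder_le_of_le atTop (x := 0) fun _ => by positivity

theorem rho_nonneg (a b : A) : 0 ≤ rho a b :=
  le_limsup_of_frequently_le (Frequently.of_forall fun _ => by positivity) (isBoundedUnder_rho a b)

theorem eventually_norm_le_pow {a b : A} {t : ℝ} (ht : rho a b < t) :
    ∀ᶠ n : ℕ in atTop, ‖(commutator a b ^ n) 1‖ ≤ t ^ n := by
  filter_upwards [eventually_lt_of_limsup_lt ht (isBoundedUnder_rho a b),
    eventually_ge_atTop 1] with n hn hn1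
  have hn0 : n ≠ 0 := by omega
  have h := pow_le_pow_left₀ (by positivity) hn.le n
  rwa [one_div, Real.rpow_inv_natCast_pow (norm_nonneg _) hn0] at h

theorem rho_le_of_eventually_norm_le_pow {a b : A} {t : ℝ} (ht : 0 ≤ t)
    (h : ∀ᶠ n : ℕ in atTop, ‖(commutator a b ^ n) 1‖ ≤ t ^ n) : rho a b ≤ t := by
  refine limsup_le_of_le (isCoboundedUnder_rho a b) ?_
  filter_upwards [h, eventually_ge_atTop 1] with n hn hn1
  have hn0 : n ≠ 0 := by omega
  calc ‖(commutator a b ^ n) 1‖ ^ (1 / (n : ℝ)) ≤ (t ^ n) ^ (1 / (n : ℝ)) :=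
        Real.rpow_le_rpow (norm_nonneg _) hn (by positivity)
    _ = t := by rw [one_div, Real.pow_rpow_inv_natCast ht hn0]

/-- By commutation the n-th power of the new commutator is `g ^ n` times that of the old one; both
factors are bounded with a margin `ε`, which then tends to `0`. -/
theorem rho_le_mul_rho {a b a' b' : A} {g : A →L[ℂ] A} {M : ℝ} (hM : 0 ≤ M)
    (hg : commutator a' b' = g * commutator a b) (hcomm : Commute g (commutator a b))
    (hpow : ∀ t > M, ∀ᶠ n : ℕ in atTop, ‖g ^ n‖ ≤ t ^ n) : rho a' b' ≤ M * rho a b := by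
  have hρ := rho_nonneg a b
  have hlim : Tendsto (fun ε : ℝ => (M + ε) * (rho a b + ε)) (𝓝[>] 0) (𝓝 (M * rho a b)) := by
    have : Continuous fun ε : ℝ => (M + ε) * (rho a b + ε) := by fun_prop
    simpa using (this.tendsto 0).mono_left nhdsWithin_le_nhds
  refine ge_of_tendsto hlim ?_
  filter_upwards [self_mem_nhdsWithin] with ε hε
  have hε : 0 < ε := hε
  refine rho_le_of_eventually_norm_le_pow (by positivity) ?_
  filter_upwards [hpow (M + ε) (by linarith),
    eventually_norm_le_pow (a := a) (b := b) (t := rho a b + ε) (by linarith)] with n h1 h2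
  rw [hg, hcomm.mul_pow, mul_apply_eq_comp, mul_pow]
  exact ((g ^ n).le_opNorm _).trans (mul_le_mul h1 h2 (norm_nonneg _) (by positivity))

end Rho

/-- Character values exhaust the spectrum, so `M` bounds the spectral radius, and Gelfand's formula
turns this into growth of powers. -/
theorem eventually_norm_pow_le_of_character {D : Type*} [NormedCommRing D] [NormedAlgebra ℂ D]
    [CompleteSpace D] {g : D} {M t : ℝ} (hM : 0 ≤ M) (h : ∀ χ : characterSpace ℂ D, ‖χ g‖ ≤ M)
    (ht : M < t) : ∀ᶠ n : ℕ in atTop, ‖g ^ n‖ ≤ t ^ n := by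
  have hr : spectralRadius ℂ g ≤ ENNReal.ofReal M := by
    refine iSup₂_le fun k hk => ?_
    obtain ⟨χ, rfl⟩ := CharacterSpace.mem_spectrum_iff_exists.1 hk
    rw [← enorm_eq_nnnorm, ← ofReal_norm]
    exact ENNReal.ofReal_le_ofReal (h χ)
  have hlt : spectralRadius ℂ g < ENNReal.ofReal t :=
    hr.trans_lt ((ENNReal.ofReal_lt_ofReal_iff (hM.trans_lt ht)).2 ht)
  filter_upwards [(spectrum.pow_norm_pow_one_div_tendsto_nhds_spectralRadius g).eventually_lt_const
    hlt, eventually_ge_atTop 1] with n hn hn1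
  have hn0 : n ≠ 0 := by omega
  rw [ENNReal.ofReal_lt_ofReal_iff (hM.trans_lt ht)] at hn
  have h := pow_le_pow_left₀ (by positivity) hn.le n
  rwa [one_div, Real.rpow_inv_natCast_pow (norm_nonneg _) hn0] at h

/-- Multiplicativity of `T` is not required, only that it carries resolvents to resolvents; right
multiplication, which reverses products, is thereby included. -/
theorem map_rieszIntegral {A B : Type*} [NormedRing A] [NormedAlgebra ℂ A] [CompleteSpace A]
    [NormedRing B] [NormedAlgebra ℂ B] [CompleteSpace B] (T : A →L[ℂ] B) {a : A} {b : B}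
    {Γ : Contour} (hT : ∀ z ∈ Γ.trace, T (resolvent a z) = resolvent b z) {U : Set ℂ}
    (hΓ : Γ.Surrounds (spectrum ℂ a) U) {f : ℂ → ℂ} (hf : ContinuousOn f U) :
    T (rieszIntegral Γ f a) = rieszIntegral Γ f b := by
  have hσ : ∀ z ∈ Γ.trace, z ∉ spectrum ℂ a := fun z hz => (hΓ.trace_subset hz).2
  rw [rieszIntegral, rieszIntegral, map_smul, ← Contour.integral_clm T
    ((hf.mono fun z hz => (hΓ.trace_subset hz).1).fun_smul (continuousOn_resolvent hσ))]
  congr 1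
  refine Contour.integral_congr fun z hz => ?_
  rw [map_smul, hT z hz]

/-! ### Reduction of a commuting pair to the commutative case -/

section Bicommutant

variable {B : Type*} [NormedRing B] [NormedAlgebra ℂ B]

theorem commute_resolvent {x c : B} {z : ℂ} (hz : z ∉ spectrum ℂ x) (h : Commute c x) :
    Commute c (resolvent x z) := by
  have hc : Commute c (algebraMap ℂ B z - x) := Commute.sub_right (Algebra.commutes z c).symm h
  calc c * resolvent x z
      = resolvent x z * ((algebraMap ℂ B z - x) * c) * resolvent x z := by
        rw [← mul_assoc, resolvent_mul_sub hz, one_mul]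
    _ = resolvent x z * c := by
        rw [← hc.eq, ← mul_assoc, mul_assoc _ _ (resolvent x z), sub_mul_resolvent hz, mul_one]

variable [CompleteSpace B]

/-- For commuting `x` and `y`, `f(x) - f(y)` is the multiple of `x - y` by an element that commutes
with `x - y` and whose spectral radius is at most the bound of the divided differences of `f`. -/
theorem exists_rieszIntegral_sub_eq_mul_of_commute {x y : B} (hxy : Commute x y) {Γ Γ' : Contour}
    {U : Set ℂ} {f : ℂ → ℂ} (hU : IsOpen U) (hf : DifferentiableOn ℂ f U)
    (hΓ : Γ.Surrounds (spectrum ℂ x) U) (hΓ' : Γ'.Surrounds (spectrum ℂ y) U) {M : ℝ} (hM : 0 ≤ M)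
    (hfM : ∀ v ∈ spectrum ℂ x, ∀ w ∈ spectrum ℂ y, ‖dslope f w v‖ ≤ M) :
    ∃ g : B, rieszIntegral Γ f x - rieszIntegral Γ' f y = g * (x - y) ∧ Commute g (x - y) ∧
      ∀ t > M, ∀ᶠ n : ℕ in atTop, ‖g ^ n‖ ≤ t ^ n := by
  have hS : ∀ u ∈ ({x, y} : Set B), ∀ v ∈ ({x, y} : Set B), u * v = v * u := by
    rintro u (rfl | rfl) v (rfl | rfl)
    · rfl
    · exact hxy
    · exact hxy.symm
    · rfl
  -- The bicommutant is commutative because `x` and `y` commute, complete because it is closed, and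
  -- it contains their resolvents, so their spectra do not grow in it.
  set D : Subalgebra ℂ B := Subalgebra.centralizer ℂ ({x, y} : Set B).centralizer
  have hDc : IsClosed (D : Set B) := Set.isClosed_centralizer _
  let _ : NormedCommRing D :=
    { (inferInstance : NormedRing D) with
      mul_comm := fun u v => Subtype.ext
        (Set.centralizer_centralizer_comm_of_comm hS u.1 u.2 v.1 v.2) }
  have : CompleteSpace D := hDc.completeSpace_coe
  have hx : x ∈ D := Set.subset_centralizer_centralizer (by simp)
  have hy : y ∈ D := Set.subset_centralizer_centralizer (by simp)
  have hres : ∀ u (hu : u ∈ D), u ∈ ({x, y} : Set B) → ∀ z ∉ spectrum ℂ u,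
      z ∉ spectrum ℂ (⟨u, hu⟩ : D) ∧ resolvent u z = resolvent (⟨u, hu⟩ : D) z := by
    intro u hu huS z hz
    have hR : resolvent u z ∈ D := fun c hc => commute_resolvent hz (hc u huS).symm
    have h1 : (algebraMap ℂ D z - ⟨u, hu⟩) * ⟨resolvent u z, hR⟩ = 1 :=
      Subtype.ext (sub_mul_resolvent hz)
    have h2 : ⟨resolvent u z, hR⟩ * (algebraMap ℂ D z - ⟨u, hu⟩) = 1 :=
      Subtype.ext (resolvent_mul_sub hz)
    exact ⟨spectrum.notMem_iff.2 ⟨⟨_, _, h1, h2⟩, rfl⟩,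
      (congrArg Subtype.val (resolvent_eq_of_mul_eq_one h1 h2)).symm⟩
  have hσx : spectrum ℂ (⟨x, hx⟩ : D) ⊆ spectrum ℂ x := fun z hz => by
    by_contra h
    exact (hres x hx (by simp) z h).1 hz
  have hσy : spectrum ℂ (⟨y, hy⟩ : D) ⊆ spectrum ℂ y := fun z hz => by
    by_contra h
    exact (hres y hy (by simp) z h).1 hz
  obtain ⟨g, hg, hgχ⟩ := exists_rieszIntegral_sub_eq_mul hU hf (hΓ.mono hσx) (hΓ'.mono hσy)
  let T : D →L[ℂ] B := D.toSubmodule.subtypeL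
  have hTx : T (rieszIntegral Γ f ⟨x, hx⟩) = rieszIntegral Γ f x :=
    map_rieszIntegral T (fun z hz => (hres x hx (by simp) z (hΓ.trace_subset hz).2).2.symm)
      (hΓ.mono hσx) hf.continuousOn
  have hTy : T (rieszIntegral Γ' f ⟨y, hy⟩) = rieszIntegral Γ' f y :=
    map_rieszIntegral T (fun z hz => (hres y hy (by simp) z (hΓ'.trace_subset hz).2).2.symm)
      (hΓ'.mono hσy) hf.continuousOn
  refine ⟨g, ?_, ?_, fun t ht => ?_⟩
  · rw [← hTx, ← hTy, ← map_sub, hg]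
    rfl
  · exact congrArg Subtype.val (mul_comm g (⟨x, hx⟩ - ⟨y, hy⟩))
  · have h := eventually_norm_pow_le_of_character hM (g := g) (fun χ => by
      rw [hgχ χ]
      exact hfM _ (hσx (character_mem_spectrum χ _)) _ (hσy (character_mem_spectrum χ _))) ht
    exact h

end Bicommutant

/-! ### Left and right multiplication operators -/

section Operators

variable {A : Type*} [NormedRing A] [NormedAlgebra ℂ A]

theorem mulLeft_resolvent_mul {a : A} {z : ℂ} (hz : z ∉ spectrum ℂ a) :
    (algebraMap ℂ (A →L[ℂ] A) z - ContinuousLinearMap.mul ℂ A a) *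
        ContinuousLinearMap.mul ℂ A (resolvent a z) = 1 ∧
      ContinuousLinearMap.mul ℂ A (resolvent a z) *
        (algebraMap ℂ (A →L[ℂ] A) z - ContinuousLinearMap.mul ℂ A a) = 1 := by
  constructor <;> ext x
  · have h := congrArg (· * x) (sub_mul_resolvent hz)
    simpa [sub_mul, mul_assoc, Algebra.algebraMap_eq_smul_one] using h
  · have h := congrArg (· * x) (resolvent_mul_sub hz)
    simpa [sub_mul, mul_sub, mul_assoc, Algebra.algebraMap_eq_smul_one] using h

theorem mulRight_resolvent_mul {a : A} {z : ℂ} (hz : z ∉ spectrum ℂ a) :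
    (algebraMap ℂ (A →L[ℂ] A) z - (ContinuousLinearMap.mul ℂ A).flip a) *
        (ContinuousLinearMap.mul ℂ A).flip (resolvent a z) = 1 ∧
      (ContinuousLinearMap.mul ℂ A).flip (resolvent a z) *
        (algebraMap ℂ (A →L[ℂ] A) z - (ContinuousLinearMap.mul ℂ A).flip a) = 1 := by
  constructor <;> ext x
  · have h := congrArg (x * ·) (resolvent_mul_sub hz)
    simpa [sub_mul, mul_sub, mul_assoc, Algebra.algebraMap_eq_smul_one] using h
  · have h := congrArg (x * ·) (sub_mul_resolvent hz)
    simpa [sub_mul, mul_sub, mul_assoc, Algebra.algebraMap_eq_smul_one] using h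

theorem spectrum_mulLeft_subset (a : A) :
    spectrum ℂ (ContinuousLinearMap.mul ℂ A a) ⊆ spectrum ℂ a := fun z hz => by
  by_contra h
  obtain ⟨h1, h2⟩ := mulLeft_resolvent_mul h
  exact spectrum.notMem_iff.2 ⟨⟨_, _, h1, h2⟩, rfl⟩ hz

theorem spectrum_mulRight_subset (a : A) :
    spectrum ℂ ((ContinuousLinearMap.mul ℂ A).flip a) ⊆ spectrum ℂ a := fun z hz => by
  by_contra h
  obtain ⟨h1, h2⟩ := mulRight_resolvent_mul h
  exact spectrum.notMem_iff.2 ⟨⟨_, _, h1, h2⟩, rfl⟩ hz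

variable [CompleteSpace A]

theorem exists_holCalc_eq {a : A} {U : Set ℂ} (hU : IsOpen U) (ha : spectrum ℂ a ⊆ U)
    (f : ℂ → ℂ) : ∃ Γ : Contour, Γ.Surrounds (spectrum ℂ a) U ∧
      holCalc U f a = rieszIntegral Γ f a := by
  have h : ∃ Γ : Contour, Γ.Surrounds (spectrum ℂ a) U :=
    let ⟨Γ, hΓ, _⟩ := exists_surrounds (spectrum.isCompact a) hU ha
    ⟨Γ, hΓ⟩
  exact ⟨h.choose, h.choose_spec, dif_pos h⟩

/-- The commuting-pair factorization is applied to `L_a` and `R_b`. Inclusion of their spectra in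
`σ(a)` and `σ(b)` suffices, as the same contours surround the smaller sets. -/
theorem rho_holCalc_le {a b : A} {U : Set ℂ} (hU : IsOpen U) {f : ℂ → ℂ}
    (hf : DifferentiableOn ℂ f U) (ha : spectrum ℂ a ⊆ U) (hb : spectrum ℂ b ⊆ U) {M : ℝ}
    (hM : 0 ≤ M) (hfM : ∀ v ∈ spectrum ℂ a, ∀ w ∈ spectrum ℂ b, ‖dslope f w v‖ ≤ M) :
    rho (holCalc U f a) (holCalc U f b) ≤ M * rho a b := by
  obtain ⟨Γ, hΓ, hfa⟩ := exists_holCalc_eq hU ha f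
  obtain ⟨Γ', hΓ', hfb⟩ := exists_holCalc_eq hU hb f
  have hcomm : Commute (ContinuousLinearMap.mul ℂ A a) ((ContinuousLinearMap.mul ℂ A).flip b) := by
    ext x
    simp [mul_assoc]
  obtain ⟨g, hg, hgc, hpow⟩ := exists_rieszIntegral_sub_eq_mul_of_commute hcomm hU hf
    (hΓ.mono (spectrum_mulLeft_subset a)) (hΓ'.mono (spectrum_mulRight_subset b)) hM
    fun v hv w hw => hfM v (spectrum_mulLeft_subset a hv) w (spectrum_mulRight_subset b hw)
  rw [hfa, hfb]
  refine rho_le_mul_rho hM ?_ hgc hpow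
  rw [commutator, map_rieszIntegral (ContinuousLinearMap.mul ℂ A) (fun z hz => ?_) hΓ
      hf.continuousOn, map_rieszIntegral (ContinuousLinearMap.mul ℂ A).flip (fun z hz => ?_) hΓ'
      hf.continuousOn, hg]
  · rfl
  · obtain ⟨h1, h2⟩ := mulRight_resolvent_mul (hΓ'.trace_subset hz).2
    exact (resolvent_eq_of_mul_eq_one h1 h2).symm
  · obtain ⟨h1, h2⟩ := mulLeft_resolvent_mul (hΓ.trace_subset hz).2
    exact (resolvent_eq_of_mul_eq_one h1 h2).symm

end Operators

/-! ### The sets of difference quotients -/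

section Quotients

variable {A : Type*} [NormedRing A] [NormedAlgebra ℂ A]

theorem norm_dslope_mem_diagonalQuotientSet (f : ℂ → ℂ) {a b : A} {v w : ℂ}
    (hv : v ∈ spectrum ℂ a) (hw : w ∈ spectrum ℂ b) :
    ‖dslope f w v‖ ∈ diagonalQuotientSet f a b := by
  refine ⟨w, hw, v, hv, ?_⟩
  rcases eq_or_ne v w with rfl | hne
  · exact Or.inr ⟨rfl, by rw [dslope_same]⟩
  · exact Or.inl ⟨hne, by rw [dslope_of_ne f hne, slope_def_field]⟩

theorem diagonalQuotientSet_subset (f : ℂ → ℂ) (a b : A) :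
    diagonalQuotientSet f a b ⊆ quotientSet f a b := by
  rintro r ⟨w, hw, v, hv, h | ⟨-, h⟩⟩
  · exact ⟨w, hw, Or.inl ⟨v, hv, h⟩⟩
  · exact ⟨w, hw, Or.inr h⟩

theorem nonneg_of_mem_quotientSet {f : ℂ → ℂ} {a b : A} {r : ℝ} (hr : r ∈ quotientSet f a b) :
    0 ≤ r := by
  obtain ⟨w, -, ⟨v, -, -, rfl⟩ | rfl⟩ := hr <;> exact norm_nonneg _

theorem bddAbove_quotientSet [CompleteSpace A] {a b : A} {U : Set ℂ} (hU : IsOpen U) {f : ℂ → ℂ}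
    (hf : DifferentiableOn ℂ f U) (hab : spectrum ℂ a ∪ spectrum ℂ b ⊆ U) :
    BddAbove (quotientSet f a b) := by
  obtain ⟨M, hM⟩ := exists_norm_dslope_le
    ((spectrum.isCompact (𝕜 := ℂ) a).union (spectrum.isCompact b)) hU hab hf
  refine ⟨M, ?_⟩
  rintro r ⟨w, hw, ⟨v, hv, hne, rfl⟩ | rfl⟩
  · rw [← slope_def_field, ← dslope_of_ne f hne]
    exact hM v (Or.inl hv) w (Or.inr hw)
  · rw [← dslope_same]
    exact hM w (Or.inr hw) w (Or.inr hw)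

end Quotients

/-! ### Equality of spectra -/

section Spectrum

variable {A : Type*} [NormedRing A] [NormedAlgebra ℂ A]

theorem QuasinilpotentEquivalent.rho_eq_zero {a b : A} (h : QuasinilpotentEquivalent a b) :
    rho a b = 0 ∧ rho b a = 0 :=
  ⟨le_antisymm ((le_max_left _ _).trans_eq h) (rho_nonneg a b),
    le_antisymm ((le_max_right _ _).trans_eq h) (rho_nonneg b a)⟩

theorem commutator_pow_succ_one (a b : A) (n : ℕ) :
    (commutator a b ^ (n + 1)) 1 = a * (commutator a b ^ n) 1 - (commutator a b ^ n) 1 * b := by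
  rw [pow_succ']
  rfl

theorem summable_norm_commutator_mul_pow {a b : A} (h : rho a b = 0) (C : ℝ) :
    Summable fun n : ℕ => ‖(commutator a b ^ n) 1‖ * C ^ n := by
  -- Since `rho a b = 0`, any positive rate is available; this one beats `C` and leaves the
  -- geometric series of ratio `1 / 2`.
  have ht : rho a b < (2 * (|C| + 1))⁻¹ := by
    rw [h]
    positivity
  refine Summable.of_norm_bounded_eventually_nat (g := fun n => (1 / 2 : ℝ) ^ n)
    (summable_geometric_of_lt_one (by norm_num) (by norm_num)) ?_
  filter_upwards [eventually_norm_le_pow ht] with n hn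
  rw [norm_mul, norm_norm, norm_pow, Real.norm_eq_abs]
  calc ‖(commutator a b ^ n) 1‖ * |C| ^ n ≤ (2 * (|C| + 1))⁻¹ ^ n * |C| ^ n := by gcongr
    _ = ((2 * (|C| + 1))⁻¹ * |C|) ^ n := by rw [mul_pow]
    _ ≤ (1 / 2) ^ n := by
      refine pow_le_pow_left₀ (by positivity) ?_ n
      rw [inv_mul_le_iff₀ (by positivity)]
      linarith

variable [CompleteSpace A]

theorem summable_commutator_mul_pow {a b : A} (h : rho a b = 0) (x : A) :
    Summable fun n : ℕ => (commutator a b ^ n) 1 * x ^ n := by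
  have h1 := summable_norm_commutator_mul_pow h ‖x‖
  rw [← summable_nat_add_iff 1] at h1 ⊢
  refine Summable.of_norm_bounded h1 fun n => ?_
  exact (norm_mul_le _ _).trans
    (mul_le_mul_of_nonneg_left (norm_pow_le' _ n.succ_pos) (norm_nonneg _))

theorem summable_pow_mul_commutator {a b : A} (h : rho a b = 0) (x : A) :
    Summable fun n : ℕ => (-x) ^ n * (commutator a b ^ n) 1 := by
  have h1 := summable_norm_commutator_mul_pow h ‖x‖
  rw [← summable_nat_add_iff 1] at h1 ⊢
  refine Summable.of_norm_bounded h1 fun n => ?_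
  refine (norm_mul_le _ _).trans ?_
  rw [mul_comm]
  refine mul_le_mul_of_nonneg_left ?_ (norm_nonneg _)
  exact (norm_pow_le' _ n.succ_pos).trans_eq (by rw [norm_neg])

/-- With `c n = C_{a,b}^n 1`, the relation `(z - a) c n = c n (z - b) - c (n + 1)` makes the series
`∑ c n R ^ (n + 1)` telescope to `c 0 = 1`. -/
theorem exists_right_inverse {a b : A} (h : rho a b = 0) {z : ℂ} (hz : z ∉ spectrum ℂ b) :
    ∃ x, (algebraMap ℂ A z - a) * x = 1 := by
  set R := resolvent b z
  set c : ℕ → A := fun n => (commutator a b ^ n) 1 with hc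
  have hs : Summable fun n => c n * R ^ n := summable_commutator_mul_pow h R
  refine ⟨(∑' n, c n * R ^ n) * R, ?_⟩
  have hterm : ∀ n, (algebraMap ℂ A z - a) * (c n * R ^ n) * R =
      c n * R ^ n - c (n + 1) * R ^ (n + 1) := by
    intro n
    have h1 : (algebraMap ℂ A z - a) * c n = c n * (algebraMap ℂ A z - b) - c (n + 1) := by
      simp only [hc, commutator_pow_succ_one, sub_mul, mul_sub, Algebra.commutes z]
      abel
    rw [← mul_assoc, h1, mul_assoc, ← pow_succ, sub_mul, pow_succ', mul_assoc,
      ← mul_assoc _ R, sub_mul_resolvent hz, one_mul]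
  have hs' := (hasSum_nat_add_iff' 1).2 hs.hasSum
  have h2 := ((hs.hasSum.mul_left (algebraMap ℂ A z - a)).mul_right R).unique
    (by simpa only [hterm] using hs.hasSum.sub hs')
  rw [← mul_assoc, h2]
  simp [hc]

/-- The mirrored series with `C_{b,a}`: here `c n (z - a) = (z - b) c n + c (n + 1)`, and the plus
sign forces powers of `-R` for the telescoping. -/
theorem exists_left_inverse {a b : A} (h : rho b a = 0) {z : ℂ} (hz : z ∉ spectrum ℂ b) :
    ∃ x, x * (algebraMap ℂ A z - a) = 1 := by
  set R := resolvent b z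
  set c : ℕ → A := fun n => (commutator b a ^ n) 1 with hc
  have hs : Summable fun n => (-R) ^ n * c n := summable_pow_mul_commutator h R
  refine ⟨R * ∑' n, (-R) ^ n * c n, ?_⟩
  have hterm : ∀ n, R * ((-R) ^ n * c n) * (algebraMap ℂ A z - a) =
      (-R) ^ n * c n - (-R) ^ (n + 1) * c (n + 1) := by
    intro n
    have h1 : c n * (algebraMap ℂ A z - a) = (algebraMap ℂ A z - b) * c n + c (n + 1) := by
      simp only [hc, commutator_pow_succ_one, sub_mul, mul_sub, Algebra.commutes z]
      abel
    have h3 : R * (-R) ^ n = (-R) ^ n * R := ((Commute.refl R).neg_right.pow_right n).eq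
    rw [← mul_assoc, mul_assoc, h1, h3, mul_add, mul_assoc _ R, ← mul_assoc R,
      resolvent_mul_sub hz, one_mul, pow_succ, mul_neg, neg_mul, sub_neg_eq_add]
  have hs' := (hasSum_nat_add_iff' 1).2 hs.hasSum
  have h2 := ((hs.hasSum.mul_left R).mul_right (algebraMap ℂ A z - a)).unique
    (by simpa only [hterm] using hs.hasSum.sub hs')
  rw [h2]
  simp [hc]

theorem spectrum_subset_of_rho_eq_zero {a b : A} (h : rho a b = 0) (h' : rho b a = 0) :
    spectrum ℂ a ⊆ spectrum ℂ b := by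
  intro z hz
  by_contra hzb
  obtain ⟨x, hx⟩ := exists_right_inverse h hzb
  obtain ⟨y, hy⟩ := exists_left_inverse h' hzb
  have hxy : y = x := left_inv_eq_right_inv hy hx
  exact spectrum.notMem_iff.2 ⟨⟨_, x, hx, hxy ▸ hy⟩, rfl⟩ hz

end Spectrum

end SpectralDistance

end

/-! ### The theorem -/

theorem theorem2p1 {A : Type*} [NormedRing A] [NormedAlgebra ℂ A] [CompleteSpace A]
    (a b : A) (U : Set ℂ) (hU : IsOpen U) (f : ℂ → ℂ) (hf : DifferentiableOn ℂ f U) :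
    (spectrum ℂ a ∪ spectrum ℂ b ⊆ U →
      BddAbove (SpectralDistance.quotientSet f a b) ∧
      SpectralDistance.rho (SpectralDistance.holCalc U f a) (SpectralDistance.holCalc U f b) ≤
        sSup (SpectralDistance.quotientSet f a b) * SpectralDistance.rho a b ∧
      SpectralDistance.rho (SpectralDistance.holCalc U f a) (SpectralDistance.holCalc U f b) ≤
        sSup (SpectralDistance.diagonalQuotientSet f a b) * SpectralDistance.rho a b) ∧
    (spectrum ℂ a ⊆ U → SpectralDistance.QuasinilpotentEquivalent a b →
      spectrum ℂ a = spectrum ℂ b ∧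
      SpectralDistance.QuasinilpotentEquivalent
        (SpectralDistance.holCalc U f a) (SpectralDistance.holCalc U f b)) := by
  open SpectralDistance in
  -- The sharper bound comes first, for arbitrary pairs: the other bound follows by inclusion of
  -- sets, and part (2) uses both orders.
  have key : ∀ a b : A, spectrum ℂ a ∪ spectrum ℂ b ⊆ U →
      rho (holCalc U f a) (holCalc U f b) ≤ sSup (diagonalQuotientSet f a b) * rho a b := by
    intro a b hab
    have hbdd := (bddAbove_quotientSet hU hf hab).mono (diagonalQuotientSet_subset f a b)
    refine rho_holCalc_le hU hf (subset_union_left.trans hab) (subset_union_right.trans hab)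
      (Real.sSup_nonneg fun r hr =>
        nonneg_of_mem_quotientSet (diagonalQuotientSet_subset f a b hr)) fun v hv w hw =>
      le_csSup hbdd (norm_dslope_mem_diagonalQuotientSet f hv hw)
  open SpectralDistance in
  refine ⟨fun hab => ?_, fun ha hq => ?_⟩
  · have hbdd := bddAbove_quotientSet hU hf hab
    refine ⟨hbdd, (key a b hab).trans
      (mul_le_mul_of_nonneg_right ?_ (SpectralDistance.rho_nonneg a b)), key a b hab⟩
    refine Real.sSup_le (fun r hr => le_csSup hbdd
      (SpectralDistance.diagonalQuotientSet_subset f a b hr)) (Real.sSup_nonneg fun r hr =>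
        SpectralDistance.nonneg_of_mem_quotientSet hr)
  · obtain ⟨h1, h2⟩ := hq.rho_eq_zero
    have hσ : spectrum ℂ a = spectrum ℂ b :=
      (SpectralDistance.spectrum_subset_of_rho_eq_zero h1 h2).antisymm
        (SpectralDistance.spectrum_subset_of_rho_eq_zero h2 h1)
    have hb : spectrum ℂ b ⊆ U := hσ ▸ ha
    have k1 := key a b (union_subset ha hb)
    have k2 := key b a (union_subset hb ha)
    rw [h1, mul_zero] at k1
    rw [h2, mul_zero] at k2
    exact ⟨hσ, le_antisymm (max_le k1 k2) (le_max_of_le_left (SpectralDistance.rho_nonneg _ _))⟩
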